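/- **Conventions.** For $(\vec a|\vec b)\in\mathbf F_2^{2n}$ let $w_s(\vec a|\vec b)=|\{i:(a_i,b_i)\ne(0,0)\}|$, and let $\perp s$ denote the dual with respect to the symplectic form $\langle\vec a,\vec d\rangle-\langle\vec b,\vec c\rangle$ of $(\vec a|\vec b)$ and $(\vec c|\vec d)$. A (binary) $[[n,k,d]]_2$ stabilizer code is a linear space $C\subset C^{\perp s}\subset\mathbf F_2^{2n}$ with $k=n-\dim C$ and $d=\min\{w_s(v):v\in C^{\perp s}\setminus C\}$; it is pure if also $d=\min\{w_s(v):v\in C^{\perp s}\setminus\{0\}\}$. An $[[n,K,d;c]]_2$ entanglement-assisted code (EAQECC) is a linear space $D\subset\mathbf F_2^{2n}$ with $\dim D=n-K+c$, $\dim D-\dim(D\cap D^{\perp s})=2c$ and $w_s(v)\ge d$ for all $v\in D^{\perp s}\setminus D$. Let $|\Psi\rangle=(|00\rangle+|11\rangle)/\sqrt2$. *Protocol of a stabilizer code $C$ with $k=n-\dim C$.* Fix a basis $\vec h_1,\dots,\vec h_{r}$ of $C$ ($r=n-k$), the corresponding Pauli observables, and an encoding operator, i.e. a unitary $W$ from $k$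 information qubits and $r$ ancilla qubits to $n$ qubits that maps $|x\rangle\otimes|s\rangle$ into the joint eigenspace with syndrome $s$, for all $x\in\mathbf F_2^k$ and $s\in\mathbf F_2^r$. Alice and Bob share $n$ pairs of qubits. Bob measures the observables, with syndrome $b\in\mathbf F_2^r$; Alice measures their complex conjugates, with syndrome $a\in\mathbf F_2^r$, and sends $a$ to Bob. Bob applies $U^{-1}$, where $U$ is a unitary chosen as a function of $a+b$ and of the set of erased positions (the decoder). Bob applies $W^{-1}$ and Alice $\overline W^{-1}$; both discard the ancilla qubits and keep $k$ pairs. No outcome is rejected. In the *hashing* protocol all $n$ pairs are noisy; in the *breeding* protocol some of the $n$ pairs are preshared noiseless pairs $|\Psi\rangle$, which are consumed. The protocol *corrects $t$ errors and $e$ erasures* if it outputs exactly $|\Psi\rangle^{\otimes k}$ whenever at most $t$ noisy pairs at unknown positions and at most $e$ noisy pairs at positions known to the decoder are in an arbitrary joint state and every other pair is in the state $|\Psi\rangle$. **Theorem.** Let $(m,k,d)$ be one of $$(5,3,2),\quad(7,2,3),\quad(9,1,4),\quad(15,1,6),\quad(20,14,3).$$ 1. There exists a pure $[[m+1,k+1,d]]_2$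 stabilizer code. 2. Let $C$ be any pure $[[m+1,k+1,d]]_2$ stabilizer code and let $i$ be any of its $m+1$ positions. Puncturing $C$ at $i$ gives an $[[m,k+1,d;1]]_2$ EAQECC. Moreover, for every basis of $C$, encoding operators exist, and there is a decoder such that for every encoding operator the breeding protocol of $C$ with one preshared pair at position $i$ and $m$ noisy pairs at the other positions, which outputs $k+1$ pairs (a net production of $k$ pairs), corrects $t$ errors and $e$ erasures for all $t,e\ge0$ with $2t+e<d$. 3. There is no $[[m,k,d']]_2$ stabilizer code with $d'\ge d$. 4. For every self-orthogonal $C\subset\mathbf F_2^{2m}$ with $\dim C=m-k$, every basis of $C$, every encoding operator, every decoder, and all $t,e\ge0$ with $2t+e=d-1$, the hashing protocol of $C$ from $m$ noisy pairs to $k$ pairs does not correct $t$ errors and $e$ erasures. In particular, for $(5,3,2)$: every pure $[[6,4,2]]_2$ code gives a breeding protocol with a net production of $3$ maximally entangled pairs from $5$ noisy pairs that corrects one erasure, and such codes exist, whereas no $[[5,3,2]]_2$ stabilizer code exists and no one-way hashing protocol constructed from a stabilizer code does the same. -/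

import Mathlib

open Matrix
open scoped ComplexOrder

namespace EntDist

noncomputable section

/-! ### Binary vectors `(a|b)`, symplectic form, symplectic weight, stabilizer codes -/

/-- Vectors `(a|b)` in `𝔽₂^{2n}`. -/
abbrev PVec (n : ℕ) : Type := (Fin n → ZMod 2) × (Fin n → ZMod 2)

/-- The symplectic inner product `⟨a, d⟩ - ⟨b, c⟩` of `(a|b)` and `(c|d)`. -/
def sympl {n : ℕ} (u v : PVec n) : ZMod 2 := u.1 ⬝ᵥ v.2 - u.2 ⬝ᵥ v.1

/-- The symplectic weight, the number of `i` with `(a_i, b_i) ≠ (0, 0)`. -/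
def wt {n : ℕ} (v : PVec n) : ℕ := (Finset.univ.filter fun i => (v.1 i, v.2 i) ≠ (0, 0)).card

/-- The symplectic dual of a linear space. -/
def symplDual {n : ℕ} (C : Submodule (ZMod 2) (PVec n)) : Submodule (ZMod 2) (PVec n) where
  carrier := {v | ∀ u ∈ C, sympl u v = 0}
  zero_mem' := by
    intro u _
    simp [sympl]
  add_mem' := by
    intro v w hv hw u hu
    have h1 := hv u hu
    have h2 := hw u hu
    simp only [sympl, Prod.fst_add, Prod.snd_add, dotProduct_add] at h1 h2 ⊢
    linear_combination h1 + h2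
  smul_mem' := by
    intro c v hv u hu
    have h1 := hv u hu
    simp only [sympl, Prod.smul_fst, Prod.smul_snd, dotProduct_smul, smul_eq_mul] at h1 ⊢
    linear_combination c * h1

/-- `C` is an `[[n, k, d]]_2` stabilizer code: `C` is self-orthogonal, `k = n - dim C`, and `d` is
the minimum of the symplectic weights of the vectors in `C^⊥ \ C`. -/
structure IsStabilizerCode (n k d : ℕ) (C : Submodule (ZMod 2) (PVec n)) : Prop where
  self_orthogonal : C ≤ symplDual C
  dim_eq : Module.finrank (ZMod 2) C + k = n
  dist_eq : IsLeast {w : ℕ | ∃ v ∈ symplDual C, v ∉ C ∧ wt v = w} d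

/-- `C` is a pure `[[n, k, d]]_2` stabilizer code: moreover `d` is the minimum of the symplectic
weights of the nonzero vectors in `C^⊥`. -/
structure IsPureStabilizerCode (n k d : ℕ) (C : Submodule (ZMod 2) (PVec n)) : Prop
    extends IsStabilizerCode n k d C where
  pure_dist_eq : IsLeast {w : ℕ | ∃ v ∈ symplDual C, v ≠ 0 ∧ wt v = w} d

/-! ### Puncturing and entanglement-assisted codes -/

/-- Deletion of the `i`-th components of both halves of `(a|b)`. -/
def deleteAt {m : ℕ} (i : Fin (m + 1)) : PVec (m + 1) →ₗ[ZMod 2] PVec m where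
  toFun v := (fun j => v.1 (i.succAbove j), fun j => v.2 (i.succAbove j))
  map_add' _ _ := rfl
  map_smul' _ _ := rfl

/-- The code punctured at position `i`. -/
def puncture {m : ℕ} (i : Fin (m + 1)) (C : Submodule (ZMod 2) (PVec (m + 1))) :
    Submodule (ZMod 2) (PVec m) := C.map (deleteAt i)

/-- The linear space `D` is an `[[n, K, d; c]]_2` entanglement-assisted code: `n` noisy qubits carry
`K = n - dim D + c` qubits of information with the help of
`c = (dim D - dim (D ∩ D^⊥)) / 2` shared maximally entangled pairs, and
the vectors in `D^⊥ \ D` have symplectic weight at least `d`. -/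
structure IsEACode (n K d c : ℕ) (D : Submodule (ZMod 2) (PVec n)) : Prop where
  dim_eq : Module.finrank (ZMod 2) D + K = n + c
  ebits_eq : Module.finrank (ZMod 2) D =
    Module.finrank (ZMod 2) (D ⊓ symplDual D : Submodule (ZMod 2) (PVec n)) + 2 * c
  dist_ge : ∀ v ∈ symplDual D, v ∉ D → d ≤ wt v

/-! ### Qubits, Pauli operators, syndrome measurement -/

/-- Labels of the computational basis of `n` qubits. -/
abbrev Bits (n : ℕ) : Type := Fin n → ZMod 2

/-- The one-qubit Pauli matrices: `I`, `X`, `Z`, `Y = iXZ` for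
`(a, b) = (0,0), (1,0), (0,1), (1,1)`. -/
def pauli₁ (a b : ZMod 2) : Matrix (ZMod 2) (ZMod 2) ℂ :=
  Matrix.of fun x y =>
    if x = y + a then Complex.I ^ (a.val * b.val) * (-1) ^ (b.val * y.val) else 0

/-- The `n`-qubit Pauli observable of `(a|b)`, the tensor product of the `pauli₁ (a_j) (b_j)`. -/
def pauli {n : ℕ} (v : PVec n) : Matrix (Bits n) (Bits n) ℂ :=
  Matrix.of fun x y => ∏ j, pauli₁ (v.1 j) (v.2 j) (x j) (y j)

/-- The projection belonging to the outcome `s` of the measurement of the observables of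
`h 0, …, h (r-1)`, where the outcome `s_i` stands for the eigenvalue `(-1)^{s_i}`. -/
def syndromeProj {n r : ℕ} (h : Fin r → PVec n) (s : Bits r) : Matrix (Bits n) (Bits n) ℂ :=
  (List.ofFn fun i => (1 / 2 : ℂ) • (1 + (-1 : ℂ) ^ (s i).val • pauli (h i))).prod

/-- `W` is an encoding operator: a unitary from `k` information qubits and `r` ancilla qubits to
`n` qubits that sends `|x⟩ ⊗ |s⟩` into the joint eigenspace with syndrome `s`, for all `x`, `s`. -/
structure IsEncoder {n r : ℕ} (k : ℕ) (h : Fin r → PVec n)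
    (W : Matrix (Bits n) (Bits k × Bits r) ℂ) : Prop where
  conjTranspose_mul_self : Wᴴ * W = 1
  mul_conjTranspose_self : W * Wᴴ = 1
  mem_eigenspace : ∀ (x : Bits k) (s : Bits r),
    syndromeProj h s *ᵥ (fun y => W y (x, s)) = fun y => W y (x, s)

/-! ### States of pairs of qubits shared by Alice (first factor) and Bob (second factor) -/

/-- Coefficients of `|Ψ⟩ = (|00⟩ + |11⟩)/√2`. -/
def psi (x y : ZMod 2) : ℂ := if x = y then 1 / (Real.sqrt 2 : ℂ) else 0

/-- Density matrix of `|Ψ⟩^{⊗k}`. -/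
def maxEnt (k : ℕ) : Matrix (Bits k × Bits k) (Bits k × Bits k) ℂ :=
  Matrix.of fun p q => ∏ j, psi (p.1 j) (p.2 j) * star (psi (q.1 j) (q.2 j))

/-- The state of `n` pairs in which the pairs at the positions in `S` are in the joint state `σ` and
each of the other pairs is in the state `|Ψ⟩`. -/
def pairState {n : ℕ} (S : Finset (Fin n))
    (σ : Matrix ((S → ZMod 2) × (S → ZMod 2)) ((S → ZMod 2) × (S → ZMod 2)) ℂ) :
    Matrix (Bits n × Bits n) (Bits n × Bits n) ℂ :=
  Matrix.of fun p q =>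
    σ (fun j => p.1 j, fun j => p.2 j) (fun j => q.1 j, fun j => q.2 j) *
      ∏ j ∈ Sᶜ, psi (p.1 j) (p.2 j) * star (psi (q.1 j) (q.2 j))

/-- Partial trace over the `r` ancilla qubits of Alice and the `r` ancilla qubits of Bob. -/
def discardAncillas {k r : ℕ}
    (τ : Matrix ((Bits k × Bits r) × (Bits k × Bits r)) ((Bits k × Bits r) × (Bits k × Bits r)) ℂ) :
    Matrix (Bits k × Bits k) (Bits k × Bits k) ℂ :=
  Matrix.of fun p q =>
    ∑ a : Bits r, ∑ b : Bits r, τ ((p.1, a), (p.2, b)) ((q.1, a), (q.2, b))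

/-! ### The entanglement distillation protocol -/

/-- The (non-normalized) effect on the `n` pairs when Alice gets the syndrome `a` and Bob gets the
syndrome `b`: Alice applies the complex conjugate of the projection for `a` (this is the measurement
for `C⋆`, since `X^a Z^{-b}` is the complex conjugate of `X^a Z^b`), Bob the projection
for `b`; Bob, who learns `a`, undoes the unitary `U (a + b)` which his decoder prescribes for
the syndrome `a + b`; then Bob applies the inverse of `W`, and Alice that of the complex
conjugate of `W`. -/
def branchOp {n k r : ℕ} (h : Fin r → PVec n) (W : Matrix (Bits n) (Bits k × Bits r) ℂ)
    (U : Bits r → Matrix.unitaryGroup (Bits n) ℂ) (a b : Bits r) :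
    Matrix ((Bits k × Bits r) × (Bits k × Bits r)) (Bits n × Bits n) ℂ :=
  Matrix.kroneckerMap (· * ·)
    ((W.map star)ᴴ * (syndromeProj h a).map star)
    (Wᴴ * (U (a + b) : Matrix (Bits n) (Bits n) ℂ)ᴴ * syndromeProj h b)

/-- Output of the one-way protocol for the input `ρ`: the average over all measurement outcomes (none
is rejected) of the state of the `k` retained pairs. -/
def edpOutput {n k r : ℕ} (h : Fin r → PVec n) (W : Matrix (Bits n) (Bits k × Bits r) ℂ)
    (U : Bits r → Matrix.unitaryGroup (Bits n) ℂ)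
    (ρ : Matrix (Bits n × Bits n) (Bits n × Bits n) ℂ) :
    Matrix (Bits k × Bits k) (Bits k × Bits k) ℂ :=
  ∑ a : Bits r, ∑ b : Bits r,
    discardAncillas (branchOp h W U a b * ρ * (branchOp h W U a b)ᴴ)

/-- The protocol corrects `t` errors and `e` erasures, when the pairs at the positions in `P` are
preshared noiseless pairs: it outputs exactly `|Ψ⟩^{⊗k}` whenever at most `t` noisy pairs at
unknown positions (the set `T`) and at most `e` noisy pairs at positions known to Bob's decoder
(the set `E`) are in an arbitrary joint state `σ`, and the other pairs are in the state `|Ψ⟩`. -/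
def EDPCorrects {n k r : ℕ} (P : Finset (Fin n)) (h : Fin r → PVec n)
    (W : Matrix (Bits n) (Bits k × Bits r) ℂ)
    (U : Finset (Fin n) → Bits r → Matrix.unitaryGroup (Bits n) ℂ) (t e : ℕ) : Prop :=
  ∀ T E : Finset (Fin n), T.card ≤ t → E.card ≤ e → Disjoint P (T ∪ E) →
    ∀ σ : Matrix (((T ∪ E : Finset (Fin n)) → ZMod 2) × ((T ∪ E : Finset (Fin n)) → ZMod 2))
        (((T ∪ E : Finset (Fin n)) → ZMod 2) × ((T ∪ E : Finset (Fin n)) → ZMod 2)) ℂ,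
      σ.PosSemidef → σ.trace = 1 →
        edpOutput h W (U E) (pairState (T ∪ E) σ) = maxEnt k

/-- Hashing protocol of a code with generators `h`: no preshared pairs. -/
def HashingCorrects {n k r : ℕ} (h : Fin r → PVec n)
    (W : Matrix (Bits n) (Bits k × Bits r) ℂ)
    (U : Finset (Fin n) → Bits r → Matrix.unitaryGroup (Bits n) ℂ) (t e : ℕ) : Prop :=
  EDPCorrects ∅ h W U t e

/-- Breeding protocol of the code with generators `h` on `m + 1` qubits, with one preshared pair,
which takes the position `i`, and `m` noisy pairs at the other positions. -/
def BreedingCorrects {m k r : ℕ} (i : Fin (m + 1)) (h : Fin r → PVec (m + 1))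
    (W : Matrix (Bits (m + 1)) (Bits k × Bits r) ℂ)
    (U : Finset (Fin (m + 1)) → Bits r → Matrix.unitaryGroup (Bits (m + 1)) ℂ) (t e : ℕ) : Prop :=
  EDPCorrects {i} h W U t e

end

end EntDist

/-!
Existence of the codes is a computation. The five pure codes are given by the syndromes of the
single-qubit errors, and an error of weight `w` with zero syndrome would split into two errors of
weights about `w / 2` with equal syndromes, so that the check `isPureStabilizerCode_codeOfColumns`
runs only over errors of about half the weight.

Nonexistence of the shorter codes is linear programming duality. For a self-orthogonal `C` with dual
distance at least `d` outside of `C`, the MacWilliams identities (`sum_kraw_eq`) hold with equal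
weight enumerators of `C` and its dual below `d`; moreover `c ↦ (-1)^(wt c)` is a character of `C`,
which gives the shadow inequalities (`sum_shadow_nonneg`). In each of the five cases an explicit
combination of these relations is contradictory (`linear_programming_bound`, `exists_wt_lt`).

For the protocols, the pure states of `n` pairs are written as `vec M` for operators `M` on `n`
qubits, with `vec 1` proportional to `|Ψ⟩^{⊗n}`; Alice's operations then act on `M` from the right
and Bob's from the left. A Pauli error `u` makes the two syndromes differ by the syndrome of `u`
(`branch_pauli`), and what it leaves behind after the correction is an operator `correctedError` on
information and ancilla qubits.

* The state with an arbitrary joint state of the pairs at the positions in `S` is a combination of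
  the products of `vec (pauli u)` with the adjoints of `vec (pauli v)`, where `u` and `v` are
  supported in `S` (`pairState_eq_sum`, `tensor_mem_pauliSpan`). If `2t + e < d`, purity makes the syndrome determine the error among those which the decoder considers
  (`exists_decoder`). Hence the measurement destroys all terms with `u ≠ v`, and in the other terms
  the error is undone (`edpOutput_pairState`).
* If the hashing protocol corrects a Pauli error, the corrected error acts on the ancilla qubits
  only (`exists_correctedError_eq`). A vector `v` of the dual code of weight at most `2t + e` is the
  sum of two correctable errors with the same syndrome and the same erased positions, so that its
  Pauli operator acts on the ancilla qubits only as well, and then `v` lies in `C`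
  (`mem_of_acts_on_ancillas`). So the minimum distance would be more than `2t + e = d - 1`, and the
  linear programming bound applies (`lt_wt_of_hashingCorrects`).

Puncturing a pure code at one position is injective, and exactly the vectors that vanish at this
position give vectors of the radical (`isEACode_puncture`).
-/

namespace EntDist

/-! ### The symplectic form -/

/-- The symplectic product as a bilinear form. -/
def symplForm (n : ℕ) : LinearMap.BilinForm (ZMod 2) (PVec n) :=
  LinearMap.mk₂ (ZMod 2) sympl
    (fun u v w => by simp only [sympl, Prod.fst_add, Prod.snd_add, add_dotProduct]; ring)
    (fun c u v => by
      simp only [sympl, Prod.smul_fst, Prod.smul_snd, smul_dotProduct, smul_eq_mul]; ring)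
    (fun u v w => by simp only [sympl, Prod.fst_add, Prod.snd_add, dotProduct_add]; ring)
    (fun c u v => by
      simp only [sympl, Prod.smul_fst, Prod.smul_snd, dotProduct_smul, smul_eq_mul]; ring)

@[simp] theorem symplForm_apply {n : ℕ} (u v : PVec n) : symplForm n u v = sympl u v := rfl

theorem sympl_add_left {n : ℕ} (u v w : PVec n) : sympl (u + v) w = sympl u w + sympl v w :=
  (symplForm n).map_add₂ u v w

theorem sympl_add_right {n : ℕ} (u v w : PVec n) : sympl u (v + w) = sympl u v + sympl u w :=
  (symplForm n u).map_add v w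

theorem sympl_comm {n : ℕ} (u v : PVec n) : sympl u v = sympl v u := by
  simp only [sympl, CharTwo.sub_eq_add, dotProduct_comm v.1, dotProduct_comm v.2]
  ring

theorem sympl_eq_sum {n : ℕ} (u v : PVec n) :
    sympl u v = ∑ j, (u.1 j * v.2 j + u.2 j * v.1 j) := by
  simp only [sympl, CharTwo.sub_eq_add, dotProduct, Finset.sum_add_distrib]

theorem symplForm_isRefl (n : ℕ) : (symplForm n).IsRefl := fun u v h => by
  simpa [sympl_comm v u] using h

theorem eq_zero_of_sympl_eq_zero {n : ℕ} (v : PVec n) (h : ∀ u, sympl v u = 0) : v = 0 := by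
  ext j
  · simpa [sympl] using h (0, Pi.single j 1)
  · simpa [sympl] using h (Pi.single j 1, 0)

theorem symplForm_nondegenerate (n : ℕ) : (symplForm n).Nondegenerate :=
  ⟨fun v h => eq_zero_of_sympl_eq_zero v h,
    fun v h => eq_zero_of_sympl_eq_zero v fun u => by rw [sympl_comm]; exact h u⟩

theorem mem_symplDual {n : ℕ} {C : Submodule (ZMod 2) (PVec n)} {v : PVec n} :
    v ∈ symplDual C ↔ ∀ u ∈ C, sympl u v = 0 := Iff.rfl

theorem symplDual_eq_orthogonal {n : ℕ} (C : Submodule (ZMod 2) (PVec n)) :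
    symplDual C = (symplForm n).orthogonal C := rfl

theorem symplDual_symplDual {n : ℕ} (C : Submodule (ZMod 2) (PVec n)) :
    symplDual (symplDual C) = C := by
  rw [symplDual_eq_orthogonal, symplDual_eq_orthogonal]
  exact LinearMap.BilinForm.orthogonal_orthogonal (symplForm_nondegenerate n)
    (symplForm_isRefl n) C

theorem finrank_PVec (n : ℕ) : Module.finrank (ZMod 2) (PVec n) = 2 * n := by
  simp [PVec, two_mul]

theorem finrank_symplDual {n : ℕ} (C : Submodule (ZMod 2) (PVec n)) :
    Module.finrank (ZMod 2) (symplDual C) = 2 * n - Module.finrank (ZMod 2) C := by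
  rw [symplDual_eq_orthogonal, LinearMap.BilinForm.finrank_orthogonal (symplForm_nondegenerate n),
    finrank_PVec]

theorem card_submodule {n : ℕ} (C : Submodule (ZMod 2) (PVec n)) :
    Nat.card C = 2 ^ Module.finrank (ZMod 2) C := by
  rw [Module.natCard_eq_pow_finrank (K := ZMod 2), Nat.card_zmod]

/-! ### Syndromes -/

/-- The syndrome of `v` with respect to the family `h`. -/
def syndrome {n r : ℕ} (h : Fin r → PVec n) : PVec n →ₗ[ZMod 2] Bits r :=
  LinearMap.pi fun i => symplForm n (h i)

@[simp] theorem syndrome_apply {n r : ℕ} (h : Fin r → PVec n) (v : PVec n) (i : Fin r) :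
    syndrome h v i = sympl (h i) v := rfl

theorem syndrome_eq_zero_iff {n r : ℕ} {C : Submodule (ZMod 2) (PVec n)}
    (h : Module.Basis (Fin r) (ZMod 2) C) (v : PVec n) :
    syndrome (fun j => (h j : PVec n)) v = 0 ↔ v ∈ symplDual C := by
  constructor
  · intro hv u hu
    have h0 : (symplForm n).flip v ∘ₗ C.subtype = 0 := h.ext fun i => by
      simpa using congrFun hv i
    simpa using LinearMap.congr_fun h0 ⟨u, hu⟩
  · intro hv
    ext i
    exact hv _ (h i).2

theorem syndrome_surjective {n r : ℕ} {C : Submodule (ZMod 2) (PVec n)}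
    (h : Module.Basis (Fin r) (ZMod 2) C) :
    Function.Surjective (syndrome (fun j => (h j : PVec n))) := by
  rw [← LinearMap.range_eq_top]
  apply Submodule.eq_top_of_finrank_eq
  have hk : LinearMap.ker (syndrome (fun j => (h j : PVec n))) = symplDual C := by
    ext v
    rw [LinearMap.mem_ker, syndrome_eq_zero_iff]
  have h1 := LinearMap.finrank_range_add_finrank_ker (syndrome (fun j => (h j : PVec n)))
  have hr : Module.finrank (ZMod 2) C = r := by
    simpa using Module.finrank_eq_card_basis h
  have hle : Module.finrank (ZMod 2) C ≤ 2 * n := finrank_PVec n ▸ Submodule.finrank_le C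
  rw [hk, finrank_symplDual, finrank_PVec] at h1
  rw [Module.finrank_fin_fun]
  omega

/-! ### Symplectic support and weight -/

/-- The support of `(a|b)`, the set of `i` with `(a_i, b_i) ≠ (0, 0)`. -/
def supp {n : ℕ} (v : PVec n) : Finset (Fin n) :=
  Finset.univ.filter fun i => (v.1 i, v.2 i) ≠ (0, 0)

theorem card_supp {n : ℕ} (v : PVec n) : (supp v).card = wt v := rfl

theorem notMem_supp {n : ℕ} {v : PVec n} {i : Fin n} : i ∉ supp v ↔ v.1 i = 0 ∧ v.2 i = 0 := by
  simp [supp]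

theorem supp_add_subset {n : ℕ} (u v : PVec n) : supp (u + v) ⊆ supp u ∪ supp v := by
  intro i hi
  by_contra h
  rw [Finset.mem_union, not_or, notMem_supp, notMem_supp] at h
  exact absurd hi (notMem_supp.2 ⟨by simp [h.1.1, h.2.1], by simp [h.1.2, h.2.2]⟩)

theorem wt_eq_zero {n : ℕ} {v : PVec n} : wt v = 0 ↔ v = 0 := by
  rw [← card_supp, Finset.card_eq_zero, Finset.eq_empty_iff_forall_notMem]
  simp only [notMem_supp, Prod.ext_iff, funext_iff, forall_and]
  rfl

/-- The restriction of `(a|b)` to the positions in `S`, zero elsewhere. -/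
def restrict {n : ℕ} (S : Finset (Fin n)) (v : PVec n) : PVec n :=
  (fun i => if i ∈ S then v.1 i else 0, fun i => if i ∈ S then v.2 i else 0)

theorem supp_restrict {n : ℕ} (S : Finset (Fin n)) (v : PVec n) :
    supp (restrict S v) = S ∩ supp v := by
  ext i
  by_cases hi : i ∈ S <;> simp [restrict, supp, hi]

theorem restrict_add_restrict {n : ℕ} {S T : Finset (Fin n)} (hd : Disjoint S T) {v : PVec n}
    (hv : supp v ⊆ S ∪ T) : restrict S v + restrict T v = v := by
  have key : ∀ i, i ∉ S → i ∉ T → v.1 i = 0 ∧ v.2 i = 0 := fun i hS hT =>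
    notMem_supp.1 fun h => by simpa [hS, hT] using hv h
  ext i
  · by_cases hS : i ∈ S
    · simp [restrict, hS, Finset.disjoint_left.1 hd hS]
    · by_cases hT : i ∈ T <;> simp [restrict, hS, hT]
      exact (key i hS hT).1.symm
  · by_cases hS : i ∈ S
    · simp [restrict, hS, Finset.disjoint_left.1 hd hS]
    · by_cases hT : i ∈ T <;> simp [restrict, hS, hT]
      exact (key i hS hT).2.symm

/-! ### Signs -/

theorem neg_one_pow_val_add {R : Type*} [Ring R] (x y : ZMod 2) :
    (-1 : R) ^ (x + y).val = (-1) ^ x.val * (-1) ^ y.val := by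
  rw [ZMod.val_add, ← pow_add, ← neg_one_pow_eq_pow_mod_two]

theorem neg_one_pow_val_sum {R ι : Type*} [CommRing R] (s : Finset ι) (f : ι → ZMod 2) :
    (-1 : R) ^ (∑ i ∈ s, f i).val = ∏ i ∈ s, (-1) ^ (f i).val := by
  classical
  induction s using Finset.induction_on with
  | empty => simp
  | insert a s ha ih => rw [Finset.sum_insert ha, Finset.prod_insert ha, neg_one_pow_val_add, ih]

theorem neg_one_pow_val_eq_one_iff {R : Type*} [Ring R] [NeZero (2 : R)] {x : ZMod 2} :
    (-1 : R) ^ x.val = 1 ↔ x = 0 := by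
  have h2 : (-1 : R) ≠ 1 := fun h => two_ne_zero (α := R) <| by
    rw [← one_add_one_eq_two]; nth_rewrite 1 [← h]; simp
  obtain rfl | rfl : x = 0 ∨ x = 1 := by revert x; decide
  · simp
  · simpa [ZMod.val_one] using h2

/-! ### Krawtchouk sums -/

/-- The coefficient list of `p + c (a + z p)`, where `p` has the coefficient list `l`. For `a = 0`
this is `(1 + c z) p`; in the recursion, `a` is the preceding coefficient. -/
def mulLinear (c : ℤ) : ℤ → List ℤ → List ℤ
  | a, [] => [c * a]
  | a, b :: l => (b + c * a) :: mulLinear c b l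

/-- The coefficients of `(1 - z)^i (1 + 3 z)^l`. -/
def krawList (i l : ℕ) : List ℤ :=
  (mulLinear (-1) 0)^[i] ((mulLinear 3 0)^[l] [1])

theorem krawList_succ_left (i l : ℕ) :
    krawList (i + 1) l = mulLinear (-1) 0 (krawList i l) :=
  Function.iterate_succ_apply' _ _ _

theorem krawList_zero_succ (l : ℕ) : krawList 0 (l + 1) = mulLinear 3 0 (krawList 0 l) :=
  Function.iterate_succ_apply' _ _ _

/-- The quaternary Krawtchouk number: the coefficient of `z^j` in `(1 - z)^i (1 + 3 z)^l`. -/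
def kraw (i l j : ℕ) : ℤ := (krawList i l).getD j 0

theorem getD_mulLinear_zero (c a : ℤ) (l : List ℤ) :
    (mulLinear c a l).getD 0 0 = l.getD 0 0 + c * a := by
  cases l <;> simp [mulLinear]

theorem getD_mulLinear_succ (c a : ℤ) (l : List ℤ) (j : ℕ) :
    (mulLinear c a l).getD (j + 1) 0 = l.getD (j + 1) 0 + c * l.getD j 0 := by
  induction l generalizing a j with
  | nil => simp [mulLinear]
  | cons b l ih =>
    cases j with
    | zero => simpa [mulLinear] using getD_mulLinear_zero c b l
    | succ j => simpa [mulLinear] using ih b j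

theorem kraw_left_zero (i l : ℕ) : kraw (i + 1) l 0 = kraw i l 0 := by
  simpa [kraw, krawList_succ_left] using getD_mulLinear_zero (-1) 0 (krawList i l)

theorem kraw_left_succ (i l j : ℕ) : kraw (i + 1) l (j + 1) = kraw i l (j + 1) - kraw i l j := by
  simpa [kraw, krawList_succ_left, sub_eq_add_neg] using getD_mulLinear_succ (-1) 0 (krawList i l) j

theorem kraw_right_zero (i l : ℕ) : kraw i (l + 1) 0 = kraw i l 0 := by
  induction i with
  | zero => simpa [kraw, krawList_zero_succ] using getD_mulLinear_zero 3 0 (krawList 0 l)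
  | succ i ih => rw [kraw_left_zero, kraw_left_zero, ih]

theorem kraw_right_succ (i l j : ℕ) :
    kraw i (l + 1) (j + 1) = kraw i l (j + 1) + 3 * kraw i l j := by
  induction i generalizing j with
  | zero => simpa [kraw, krawList_zero_succ] using getD_mulLinear_succ 3 0 (krawList 0 l) j
  | succ i ih =>
    rw [kraw_left_succ, kraw_left_succ, ih]
    cases j with
    | zero => rw [kraw_right_zero, kraw_left_zero]; ring
    | succ j => rw [ih, kraw_left_succ]; ring

/-- The sign `(-1)^x`. -/
def sgn (x : ZMod 2) : ℤ := (-1) ^ x.val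

theorem sgn_add (x y : ZMod 2) : sgn (x + y) = sgn x * sgn y := neg_one_pow_val_add x y

/-- `(x, v)` with `x` put in front of `v`. -/
def pcons {n : ℕ} (x : ZMod 2 × ZMod 2) (v : PVec n) : PVec (n + 1) :=
  (Fin.cons x.1 v.1, Fin.cons x.2 v.2)

/-- Splitting off the first position. -/
def pconsEquiv (n : ℕ) : (ZMod 2 × ZMod 2) × PVec n ≃ PVec (n + 1) where
  toFun p := pcons p.1 p.2
  invFun v := ((v.1 0, v.2 0), (Fin.tail v.1, Fin.tail v.2))
  left_inv p := by simp [pcons]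
  right_inv v := by simp [pcons]

theorem wt_pcons {n : ℕ} (x : ZMod 2 × ZMod 2) (v : PVec n) :
    wt (pcons x v) = wt v + if x = 0 then 0 else 1 := by
  have hw : ∀ {m : ℕ} (w : PVec m), wt w = ∑ i, if (w.1 i, w.2 i) ≠ (0, 0) then 1 else 0 :=
    fun w => Finset.card_filter _ _
  rw [hw, hw, Fin.sum_univ_succ, add_comm]
  congr 1
  change (if x ≠ 0 then 1 else 0) = _
  split_ifs <;> simp_all

theorem sympl_pcons {n : ℕ} (x y : ZMod 2 × ZMod 2) (u v : PVec n) :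
    sympl (pcons x u) (pcons y v) = (x.1 * y.2 + x.2 * y.1) + sympl u v := by
  simp [sympl_eq_sum, Fin.sum_univ_succ, pcons]

theorem wt_le {n : ℕ} (v : PVec n) : wt v ≤ n := by
  simpa [wt] using Finset.card_filter_le (Finset.univ : Finset (Fin n)) _

/-- The character sum over the vectors of a given weight is a Krawtchouk number. -/
theorem sum_sgn_of_wt {n : ℕ} (u : PVec n) (j : ℕ) :
    ∑ v : PVec n, (if wt v = j then sgn (sympl u v) else 0) = kraw (wt u) (n - wt u) j := by
  induction n generalizing j with
  | zero =>
    have h0 : ∀ v : PVec 0, v = 0 := fun v => Subsingleton.elim _ _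
    rw [h0 u]
    have hw : wt (0 : PVec 0) = 0 := wt_eq_zero.2 rfl
    rw [Fintype.sum_eq_single 0 fun v hv => absurd (h0 v) hv, hw]
    cases j <;> simp [kraw, krawList, sgn, sympl]
  | succ n ih =>
    obtain ⟨⟨x, u⟩, rfl⟩ := (pconsEquiv n).surjective u
    change ∑ v : PVec (n + 1), (if wt v = j then sgn (sympl (pcons x u) v) else 0) =
      kraw (wt (pcons x u)) (n + 1 - wt (pcons x u)) j
    rw [← (pconsEquiv n).sum_comp, Fintype.sum_prod_type]
    have step : ∀ y : ZMod 2 × ZMod 2, ∑ v : PVec n,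
        (if wt (pconsEquiv n (y, v)) = j then sgn (sympl (pcons x u) (pconsEquiv n (y, v))) else 0)
        = sgn (x.1 * y.2 + x.2 * y.1) *
          ∑ v : PVec n, (if wt v + (if y = 0 then 0 else 1) = j then sgn (sympl u v) else 0) := by
      intro y
      rw [Finset.mul_sum]
      refine Finset.sum_congr rfl fun v _ => ?_
      change (if wt (pcons y v) = j then sgn (sympl (pcons x u) (pcons y v)) else 0) = _
      rw [wt_pcons, sympl_pcons, sgn_add, mul_ite, mul_zero]
    rw [Finset.sum_congr rfl fun y _ => step y]
    have hz : ∀ v : PVec n, wt v + 1 = 0 ↔ False := fun v => by simp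
    have hle := wt_le u
    have hsum : ∀ f : ZMod 2 × ZMod 2 → ℤ,
        ∑ y, f y = f (0, 0) + f (0, 1) + f (1, 0) + f (1, 1) := fun f => by
      rw [Fintype.sum_prod_type]
      change ∑ a : Fin 2, ∑ b : Fin 2, f (a, b) = _
      simp only [Fin.sum_univ_two]
      exact (add_assoc _ _ _).symm
    have e01 : ((0, 1) : ZMod 2 × ZMod 2) ≠ 0 := by decide
    have e10 : ((1, 0) : ZMod 2 × ZMod 2) ≠ 0 := by decide
    have e11 : ((1, 1) : ZMod 2 × ZMod 2) ≠ 0 := by decide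
    have e00 : ((0, 0) : ZMod 2 × ZMod 2) = 0 := rfl
    rw [hsum, wt_pcons]
    simp only [e00, e01, e10, e11, if_true, if_false, add_zero]
    have hs0 : sgn 0 = 1 := by decide
    have hs1 : sgn 1 = -1 := by decide
    obtain ⟨a, b⟩ := x
    by_cases hx : (a, b) = 0
    · obtain ⟨rfl, rfl⟩ := Prod.ext_iff.1 hx
      have hn : n + 1 - wt u = (n - wt u) + 1 := by omega
      cases j with
      | zero =>
        simp only [hz, if_false, if_true, add_zero, hx, hn, kraw_right_zero, ← ih u]
        simp [hs0]
      | succ j =>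
        simp only [if_true, add_zero, hx, hn, kraw_right_succ, ← ih u, Nat.add_right_cancel_iff]
        simp [hs0]
        ring
    · have hn : n + 1 - (wt u + 1) = n - wt u := by omega
      cases j with
      | zero =>
        simp only [hz, if_false, hx, hn, kraw_left_zero, ← ih u]
        simp [hs0]
      | succ j =>
        simp only [if_false, hx, hn, kraw_left_succ, ← ih u, Nat.add_right_cancel_iff]
        -- a nonzero Pauli letter anticommutes with two of the three nonzero letters
        obtain ⟨rfl, rfl⟩ | ⟨rfl, rfl⟩ | ⟨rfl, rfl⟩ :
            (a = 0 ∧ b = 1) ∨ (a = 1 ∧ b = 0) ∨ (a = 1 ∧ b = 1) := by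
          clear step; revert a b; decide
        all_goals
          simp [hs0, hs1, CharTwo.add_self_eq_zero]
          ring

/-! ### Linear programming bounds -/

open Classical in
/-- The sum of the character `v` over a linear space. -/
theorem sum_sgn_sympl {n : ℕ} (C : Submodule (ZMod 2) (PVec n)) (v : PVec n) :
    ∑ c : C, sgn (sympl (c : PVec n) v) = if v ∈ symplDual C then (Nat.card C : ℤ) else 0 := by
  split_ifs with hv
  · have h : ∀ c : C, sgn (sympl (c : PVec n) v) = 1 := fun c => by rw [hv c c.2]; rfl
    simp [h, Nat.card_eq_fintype_card]
  · obtain ⟨u, hu, huv⟩ : ∃ u ∈ C, sympl u v ≠ 0 := by simpa [mem_symplDual] using hv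
    have h1 : sgn (sympl u v) = -1 := by
      have : ∀ x : ZMod 2, x ≠ 0 → sgn x = -1 := by decide
      exact this _ huv
    have h2 := Equiv.sum_comp (Equiv.addLeft (⟨u, hu⟩ : C)) fun c : C => sgn (sympl (c : PVec n) v)
    simp only [Equiv.coe_addLeft, Submodule.coe_add, sympl_add_left, sgn_add, h1, ← Finset.mul_sum]
      at h2
    linarith

theorem sum_kraw {n : ℕ} (C : Submodule (ZMod 2) (PVec n)) [Fintype C] (j : ℕ) (g : C → ℤ) :
    ∑ c : C, g c * kraw (wt (c : PVec n)) (n - wt (c : PVec n)) j =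
      ∑ v : PVec n, if wt v = j then ∑ c : C, g c * sgn (sympl (c : PVec n) v) else 0 := by
  simp_rw [← sum_sgn_of_wt, Finset.mul_sum]
  rw [Finset.sum_comm]
  refine Finset.sum_congr rfl fun v _ => ?_
  split_ifs <;> simp

open Classical in
/-- The MacWilliams identity for weights below the minimum distance: there, `C` and its dual have
the same number of vectors. -/
theorem sum_kraw_eq {n d : ℕ} {C : Submodule (ZMod 2) (PVec n)} (hC : C ≤ symplDual C)
    (hd : ∀ v ∈ symplDual C, v ∉ C → d ≤ wt v) {j : ℕ} (hj : j < d) :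
    ∑ c : C, (kraw (wt (c : PVec n)) (n - wt (c : PVec n)) j -
      if wt (c : PVec n) = j then (Nat.card C : ℤ) else 0) = 0 := by
  have h1 := sum_kraw C j fun _ => 1
  simp only [one_mul, sum_sgn_sympl] at h1
  rw [Finset.sum_sub_distrib, h1, sub_eq_zero,
    ← Finset.sum_subtype (Finset.univ.filter (· ∈ C)) (by simp)
      fun v => if wt v = j then (Nat.card C : ℤ) else 0, Finset.sum_filter]
  refine Finset.sum_congr rfl fun v _ => ?_
  by_cases hv : wt v = j
  · have hiff : v ∈ symplDual C ↔ v ∈ C :=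
      ⟨fun h => by_contra fun h' => by have := hd v h h'; omega, fun h => hC h⟩
    simp only [hiff, hv, if_true]
  · simp [hv]

/-- The symplectic form is the polarization of the parity of the weight; in particular this parity
is additive on self-orthogonal spaces. -/
theorem wt_add_mod_two {n : ℕ} (u v : PVec n) :
    (wt (u + v) : ZMod 2) = wt u + wt v + sympl u v := by
  have hw : ∀ w : PVec n, (wt w : ZMod 2) = ∑ j, (w.1 j + w.2 j + w.1 j * w.2 j) := by
    intro w
    rw [wt, Finset.card_filter, Nat.cast_sum]
    refine Finset.sum_congr rfl fun j _ => ?_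
    generalize w.1 j = a
    generalize w.2 j = b
    revert a b
    decide
  rw [hw, hw, hw, sympl_eq_sum, ← Finset.sum_add_distrib, ← Finset.sum_add_distrib]
  refine Finset.sum_congr rfl fun j _ => ?_
  simp only [Prod.fst_add, Prod.snd_add, Pi.add_apply]
  ring

open Classical in
/-- The shadow inequality: on a self-orthogonal space, `c ↦ (-1)^(wt c)` is a character, and so is
its product with the character of any vector `v`; the sum of a character is nonnegative. -/
theorem sum_shadow_nonneg {n : ℕ} {C : Submodule (ZMod 2) (PVec n)} (hC : C ≤ symplDual C)
    (j : ℕ) :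
    0 ≤ ∑ c : C, (-1) ^ wt (c : PVec n) * kraw (wt (c : PVec n)) (n - wt (c : PVec n)) j := by
  rw [sum_kraw]
  refine Finset.sum_nonneg fun v _ => ?_
  split_ifs
  swap
  · rfl
  set χ : C → ℤ := fun c => (-1) ^ wt (c : PVec n) * sgn (sympl (c : PVec n) v) with hχ
  change 0 ≤ ∑ c, χ c
  have hsgn : ∀ k : ℕ, ((-1) ^ k : ℤ) = sgn k := fun k => by
    rw [sgn, ZMod.val_natCast, ← neg_one_pow_eq_pow_mod_two]
  have hmul : ∀ a b : C, χ (a + b) = χ a * χ b := fun a b => by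
    have h0 : sympl (a : PVec n) b = 0 := hC b.2 a a.2
    simp only [hχ, hsgn, Submodule.coe_add, wt_add_mod_two, h0, add_zero, sympl_add_left, sgn_add]
    ring
  by_cases h1 : ∀ c, χ c = 1
  · simp [h1]
  · push Not at h1
    obtain ⟨a, ha⟩ := h1
    have h2 := Equiv.sum_comp (Equiv.addLeft a) χ
    simp only [Equiv.coe_addLeft, hmul, ← Finset.mul_sum] at h2
    have h3 : (χ a - 1) * ∑ c, χ c = 0 := by linarith
    rcases mul_eq_zero.1 h3 with h | h
    · exact absurd (by linarith) ha
    · exact h.ge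

/-- The contribution of a vector of weight `i` to the combination, with multipliers `Y` and `Z`, of
the MacWilliams identities and the shadow inequalities for a space with `N` vectors. -/
def lpValue (n N : ℕ) (Y Z : List ℤ) (i : ℕ) : ℤ :=
  ∑ j ∈ Finset.range Y.length, Y.getD j 0 * (kraw i (n - i) j - if i = j then (N : ℤ) else 0) +
    ∑ j ∈ Finset.range Z.length, Z.getD j 0 * ((-1) ^ i * kraw i (n - i) j)

/-- Weak duality for the quantum linear programming bound: a list of multipliers for which every
weight contributes at most `0`, and the weight `0` less than `0`, excludes codes. -/
theorem linear_programming_bound {n N d : ℕ} (Y Z : List ℤ) (hY : Y.length ≤ d)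
    (hZ : ∀ j < Z.length, 0 ≤ Z.getD j 0) (hle : ∀ i ≤ n, lpValue n N Y Z i ≤ 0)
    (hlt : lpValue n N Y Z 0 < 0) {C : Submodule (ZMod 2) (PVec n)} (hN : Nat.card C = N)
    (hC : C ≤ symplDual C) : ∃ v ∈ symplDual C, v ∉ C ∧ wt v < d := by
  classical
  by_contra! hd
  have hsum : ∑ c : C, lpValue n N Y Z (wt (c : PVec n)) < 0 := by
    refine Finset.sum_neg' (fun c _ => hle _ (wt_le _)) ⟨0, Finset.mem_univ _, ?_⟩
    rw [Submodule.coe_zero, wt_eq_zero.2 rfl]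
    exact hlt
  refine hsum.not_ge ?_
  simp only [lpValue, Finset.sum_add_distrib]
  rw [Finset.sum_comm, Finset.sum_comm (t := Finset.range Z.length)]
  simp only [← Finset.mul_sum]
  refine add_nonneg (le_of_eq ?_) (Finset.sum_nonneg fun j hj =>
    mul_nonneg (hZ j (Finset.mem_range.1 hj)) (sum_shadow_nonneg hC j))
  refine (Finset.sum_eq_zero fun j hj => ?_).symm
  rw [← hN, sum_kraw_eq hC hd ((Finset.mem_range.1 hj).trans_le hY), mul_zero]

/-- In each of the five cases no `[[m, k]]` stabilizer code has minimum distance `d` or more. -/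
theorem exists_wt_lt {m k d : ℕ} (hrow : (m, k, d) ∈
      ({(5, 3, 2), (7, 2, 3), (9, 1, 4), (15, 1, 6), (20, 14, 3)} : Set (ℕ × ℕ × ℕ)))
    {C : Submodule (ZMod 2) (PVec m)} (hC : C ≤ symplDual C)
    (hdim : Module.finrank (ZMod 2) C + k = m) : ∃ v ∈ symplDual C, v ∉ C ∧ wt v < d := by
  have hcard := card_submodule C
  -- the multipliers are dual solutions of the linear programs, scaled to be integers
  simp only [Set.mem_insert_iff, Set.mem_singleton_iff, Prod.mk.injEq] at hrow
  rcases hrow with ⟨rfl, rfl, rfl⟩ | ⟨rfl, rfl, rfl⟩ | ⟨rfl, rfl, rfl⟩ | ⟨rfl, rfl, rfl⟩ |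
    ⟨rfl, rfl, rfl⟩
  · rw [show Module.finrank (ZMod 2) C = 2 by omega] at hcard
    exact linear_programming_bound [-17, -5] [12] (by decide) (by decide)
      (by decide +kernel) (by decide +kernel) hcard hC
  · rw [show Module.finrank (ZMod 2) C = 5 by omega] at hcard
    exact linear_programming_bound [-5, -2, -1] [2, 2] (by decide) (by decide)
      (by decide +kernel) (by decide +kernel) hcard hC
  · rw [show Module.finrank (ZMod 2) C = 8 by omega] at hcard
    exact linear_programming_bound [-5436, -2388, -851, -597] [1728, 0, 940] (by decide)
      (by decide) (by decide +kernel) (by decide +kernel) hcard hC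
  · rw [show Module.finrank (ZMod 2) C = 14 by omega] at hcard
    exact linear_programming_bound [-21, -21, -6, -6, -1, -1] [42, 0, 12, 0, 2] (by decide)
      (by decide) (by decide +kernel) (by decide +kernel) hcard hC
  · rw [show Module.finrank (ZMod 2) C = 6 by omega] at hcard
    exact linear_programming_bound [-26, -1, -1] [4] (by decide) (by decide)
      (by decide +kernel) (by decide +kernel) hcard hC

/-! ### Codes given by the syndromes of the single-qubit errors -/

/-- The `l`-th binary digit of `m`. -/
def digit (m l : ℕ) : ZMod 2 := if m.testBit l then 1 else 0

theorem digit_xor (a b l : ℕ) : digit (a ^^^ b) l = digit a l + digit b l := by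
  simp only [digit, Nat.testBit_xor]
  cases a.testBit l <;> cases b.testBit l <;> decide

theorem digit_zero (l : ℕ) : digit 0 l = 0 := by simp [digit]

theorem digit_two_pow (a l : ℕ) : digit (2 ^ a) l = if a = l then 1 else 0 := by
  simp [digit, Nat.testBit_two_pow]

theorem digit_eq_zero_of_lt {m r l : ℕ} (h : m < 2 ^ r) (hl : r ≤ l) : digit m l = 0 := by
  simp [digit, Nat.testBit_lt_two_pow (h.trans_le (Nat.pow_le_pow_right two_pos hl))]

theorem eq_zero_of_digit_eq_zero {m : ℕ} (h : ∀ l, digit m l = 0) : m = 0 := by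
  refine Nat.eq_of_testBit_eq fun l => ?_
  simpa [digit] using h l

/-- The vector whose two halves have the binary digits of `a` and `b` as entries. -/
def ofMasks (n a b : ℕ) : PVec n := (fun j => digit a j, fun j => digit b j)

/-- The `l`-th generator of the code in which the errors `X` and `Z` at the `j`-th position have the
syndromes with digits `(L j).1` and `(L j).2`. -/
def generator (L : List (ℕ × ℕ)) (l : ℕ) : PVec L.length :=
  (fun j => digit (L.get j).2 l, fun j => digit (L.get j).1 l)

/-- The code in which the errors `X` and `Z` at the `j`-th position have the `r`-digit syndromes
`(L j).1` and `(L j).2`. -/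
def codeOfColumns (L : List (ℕ × ℕ)) (r : ℕ) : Submodule (ZMod 2) (PVec L.length) :=
  Submodule.span (ZMod 2) (Set.range fun l : Fin r => generator L l)

/-- The syndrome of `v`, as a number. -/
def maskSyndrome : (L : List (ℕ × ℕ)) → PVec L.length → ℕ
  | [], _ => 0
  | (x, z) :: L, v =>
    ((if v.1 0 = 0 then 0 else x) ^^^ (if v.2 0 = 0 then 0 else z)) ^^^
      maskSyndrome L (Fin.tail v.1, Fin.tail v.2)

theorem digit_maskSyndrome (L : List (ℕ × ℕ)) (v : PVec L.length) (l : ℕ) :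
    digit (maskSyndrome L v) l = sympl (generator L l) v := by
  induction L with
  | nil => simp [maskSyndrome, digit_zero, sympl]
  | cons p L ih =>
    have h2 : ∀ (x : ℕ) (a : ZMod 2), digit (if a = 0 then 0 else x) l = digit x l * a := by
      intro x a
      obtain rfl | rfl : a = 0 ∨ a = 1 := by revert a; decide
      · simp [digit_zero]
      · simp
    have hs := sympl_eq_sum (generator (p :: L) l) v
    refine Eq.trans ?_ (hs.trans (Fin.sum_univ_succ _)).symm
    rw [maskSyndrome, digit_xor, digit_xor, ih, h2, h2, add_comm (digit p.1 l * _),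
      sympl_eq_sum]
    rfl

theorem maskSyndrome_add (L : List (ℕ × ℕ)) (u v : PVec L.length) :
    maskSyndrome L (u + v) = maskSyndrome L u ^^^ maskSyndrome L v := by
  refine Nat.eq_of_testBit_eq fun l => ?_
  have h : digit (maskSyndrome L (u + v)) l = digit (maskSyndrome L u ^^^ maskSyndrome L v) l := by
    rw [digit_xor, digit_maskSyndrome, digit_maskSyndrome, digit_maskSyndrome, sympl_add_right]
  simp only [digit] at h
  generalize (maskSyndrome L (u + v)).testBit l = a at h ⊢
  generalize (maskSyndrome L u ^^^ maskSyndrome L v).testBit l = b at h ⊢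
  revert h
  cases a <;> cases b <;> simp

theorem maskSyndrome_zero (L : List (ℕ × ℕ)) : maskSyndrome L 0 = 0 := by
  simpa using maskSyndrome_add L 0 0

theorem maskSyndrome_eq_zero {L : List (ℕ × ℕ)} {r : ℕ}
    (hL : ∀ p ∈ L, p.1 < 2 ^ r ∧ p.2 < 2 ^ r) {v : PVec L.length}
    (hv : v ∈ symplDual (codeOfColumns L r)) : maskSyndrome L v = 0 := by
  refine eq_zero_of_digit_eq_zero fun l => ?_
  rw [digit_maskSyndrome]
  by_cases hl : l < r
  · exact hv _ (Submodule.subset_span ⟨⟨l, hl⟩, rfl⟩)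
  · have h0 : generator L l = 0 := by
      ext j
      · exact digit_eq_zero_of_lt (hL _ (List.get_mem L j)).2 (not_lt.1 hl)
      · exact digit_eq_zero_of_lt (hL _ (List.get_mem L j)).1 (not_lt.1 hl)
    simp [h0, sympl]

/-- Whether `p` holds for the syndromes, added to `s`, of all errors of weight `w`. -/
def allOfWeight (p : ℕ → Bool) : List (ℕ × ℕ) → ℕ → ℕ → Bool
  | _, 0, s => p s
  | [], _ + 1, _ => true
  | (x, z) :: L, w + 1, s =>
    allOfWeight p L (w + 1) s && (allOfWeight p L w (s ^^^ x) &&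
      (allOfWeight p L w (s ^^^ z) && allOfWeight p L w (s ^^^ (x ^^^ z))))

/-- The set of the syndromes, added to `s`, of all errors of weight `w`, encoded as the number
whose binary digits are its indicator function. -/
def maskOfWeight : List (ℕ × ℕ) → ℕ → ℕ → ℕ
  | _, 0, s => 2 ^ s
  | [], _ + 1, _ => 0
  | (x, z) :: L, w + 1, s =>
    maskOfWeight L (w + 1) s ||| (maskOfWeight L w (s ^^^ x) |||
      (maskOfWeight L w (s ^^^ z) ||| maskOfWeight L w (s ^^^ (x ^^^ z))))

/-- A property of the syndromes of all errors of a given weight is checked position by position. -/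
theorem forall_wt_of_cons {Q : List (ℕ × ℕ) → ℕ → ℕ → ℕ → Prop}
    (h0 : ∀ L s, Q L 0 s s)
    (hI : ∀ x z L w s t, Q L (w + 1) s t → Q ((x, z) :: L) (w + 1) s t)
    (hX : ∀ x z L w s t, Q L w (s ^^^ x) t → Q ((x, z) :: L) (w + 1) s t)
    (hZ : ∀ x z L w s t, Q L w (s ^^^ z) t → Q ((x, z) :: L) (w + 1) s t)
    (hY : ∀ x z L w s t, Q L w (s ^^^ (x ^^^ z)) t → Q ((x, z) :: L) (w + 1) s t)
    (L : List (ℕ × ℕ)) (v : PVec L.length) (s : ℕ) :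
    Q L (wt v) s (s ^^^ maskSyndrome L v) := by
  induction L generalizing s with
  | nil =>
    have hw : wt v = 0 := Nat.le_zero.1 (wt_le v)
    rw [hw, maskSyndrome, Nat.xor_zero]
    exact h0 _ _
  | cons p L ih =>
    obtain ⟨x, z⟩ := p
    obtain ⟨⟨⟨a, b⟩, u⟩, rfl⟩ := (pconsEquiv L.length).surjective v
    have hw : wt ((pconsEquiv L.length) ((a, b), u)) = wt u + if (a, b) = 0 then 0 else 1 :=
      wt_pcons _ _
    have hs : maskSyndrome ((x, z) :: L) ((pconsEquiv L.length) ((a, b), u)) =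
      ((if a = 0 then 0 else x) ^^^ (if b = 0 then 0 else z)) ^^^ maskSyndrome L u := rfl
    rw [hw, hs]
    have e01 : ((0, 1) : ZMod 2 × ZMod 2) ≠ 0 := by decide
    have e10 : ((1, 0) : ZMod 2 × ZMod 2) ≠ 0 := by decide
    have e11 : ((1, 1) : ZMod 2 × ZMod 2) ≠ 0 := by decide
    obtain ⟨rfl, rfl⟩ | ⟨rfl, rfl⟩ | ⟨rfl, rfl⟩ | ⟨rfl, rfl⟩ :
        (a = 0 ∧ b = 0) ∨ (a = 1 ∧ b = 0) ∨ (a = 0 ∧ b = 1) ∨ (a = 1 ∧ b = 1) := by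
      clear hw hs; revert a b; decide
    · by_cases hu : u = 0
      · simpa [hu, wt_eq_zero.2, maskSyndrome_zero] using h0 ((x, z) :: L) s
      · have h := ih u s
        obtain ⟨w, hw'⟩ := Nat.exists_eq_succ_of_ne_zero (mt wt_eq_zero.1 hu)
        simp only [Prod.mk_zero_zero, if_true, add_zero, Nat.xor_zero, Nat.zero_xor, hw'] at h ⊢
        exact hI _ _ _ _ _ _ h
    · simpa [e10, ← Nat.xor_assoc] using hX x z _ _ s _ (ih u (s ^^^ x))
    · simpa [e01, ← Nat.xor_assoc] using hZ x z _ _ s _ (ih u (s ^^^ z))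
    · simpa [e11, ← Nat.xor_assoc] using hY x z _ _ s _ (ih u (s ^^^ (x ^^^ z)))

theorem apply_maskSyndrome_of_allOfWeight {p : ℕ → Bool} {L : List (ℕ × ℕ)} {w : ℕ}
    (h : allOfWeight p L w 0 = true) {v : PVec L.length} (hv : wt v = w) :
    p (maskSyndrome L v) = true := by
  have key := forall_wt_of_cons (Q := fun L w s t => allOfWeight p L w s = true → p t = true)
    (fun L s h => by cases L <;> exact h)
    (fun x z L w s t ih h => by simp only [allOfWeight, Bool.and_eq_true] at h; exact ih h.1)
    (fun x z L w s t ih h => by simp only [allOfWeight, Bool.and_eq_true] at h; exact ih h.2.1)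
    (fun x z L w s t ih h => by simp only [allOfWeight, Bool.and_eq_true] at h; exact ih h.2.2.1)
    (fun x z L w s t ih h => by simp only [allOfWeight, Bool.and_eq_true] at h; exact ih h.2.2.2)
    L v 0
  rw [Nat.zero_xor] at key
  exact key (hv ▸ h)

theorem testBit_maskOfWeight (L : List (ℕ × ℕ)) (v : PVec L.length) :
    (maskOfWeight L (wt v) 0).testBit (maskSyndrome L v) = true := by
  have key := forall_wt_of_cons (Q := fun L w s t => (maskOfWeight L w s).testBit t = true)
    (fun L s => by cases L <;> simp [maskOfWeight])
    (fun x z L w s t ih => by simp [maskOfWeight, Nat.testBit_or, ih])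
    (fun x z L w s t ih => by simp [maskOfWeight, Nat.testBit_or, ih])
    (fun x z L w s t ih => by simp [maskOfWeight, Nat.testBit_or, ih])
    (fun x z L w s t ih => by simp [maskOfWeight, Nat.testBit_or, ih])
    L v 0
  rwa [Nat.zero_xor] at key

/-- Whether no error of weight `w - (w - 1) / 2` has the same syndrome as an error of weight
`(w - 1) / 2`. -/
def noneOfWeight (L : List (ℕ × ℕ)) (w : ℕ) : Bool :=
  allOfWeight (fun s => !(maskOfWeight L ((w - 1) / 2) 0).testBit s) L (w - (w - 1) / 2) 0

/-- An error of weight `w` with zero syndrome is the sum of two errors, of weights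
`w - (w - 1) / 2` and `(w - 1) / 2`, with equal syndromes. -/
theorem maskSyndrome_ne_zero {L : List (ℕ × ℕ)} {w : ℕ} (h : noneOfWeight L w = true)
    {v : PVec L.length} (hv : wt v = w) : maskSyndrome L v ≠ 0 := by
  intro h0
  obtain ⟨S, hS, hcard⟩ := Finset.exists_subset_card_eq (s := supp v) (n := (w - 1) / 2)
    (by rw [card_supp, hv]; omega)
  have hsum : restrict S v + restrict (supp v \ S) v = v :=
    restrict_add_restrict Finset.disjoint_sdiff (by simp)
  have h1 : wt (restrict S v) = (w - 1) / 2 := by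
    rw [← card_supp, supp_restrict, Finset.inter_eq_left.2 hS, hcard]
  have h2 : wt (restrict (supp v \ S) v) = w - (w - 1) / 2 := by
    rw [← card_supp, supp_restrict, Finset.inter_eq_left.2 Finset.sdiff_subset,
      Finset.card_sdiff_of_subset hS, hcard, card_supp, hv]
  rw [← hsum, maskSyndrome_add, Nat.xor_eq_zero_iff] at h0
  have h3 := apply_maskSyndrome_of_allOfWeight h h2
  have h4 := testBit_maskOfWeight L (restrict S v)
  rw [h1, h0] at h4
  simp [h4] at h3

/-- A criterion for pure codes in terms of the syndromes of the single-qubit errors. The vector `v`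
is a vector of minimum weight in the dual code; it is not in the code, as it is not orthogonal to
the vector `u` of the dual code. By `hunit` every syndrome with a single nonzero digit occurs, which
makes the generators independent. -/
theorem isPureStabilizerCode_codeOfColumns {L : List (ℕ × ℕ)} {r k d : ℕ} (u v : PVec L.length)
    (hk : r + k = L.length) (hlt : ∀ p ∈ L, p.1 < 2 ^ r ∧ p.2 < 2 ^ r)
    (hunit : ∀ l < r, ∃ p ∈ L, p.1 = 2 ^ l ∨ p.2 = 2 ^ l)
    (horth : ∀ l m : Fin r, sympl (generator L l) (generator L m) = 0)
    (hdist : ∀ w < d, 0 < w → noneOfWeight L w = true)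
    (hu : ∀ l : Fin r, sympl (generator L l) u = 0)
    (hv : ∀ l : Fin r, sympl (generator L l) v = 0)
    (huv : sympl u v ≠ 0) (hwt : wt v = d) :
    IsPureStabilizerCode L.length k d (codeOfColumns L r) := by
  have hmem : ∀ w : PVec L.length, (∀ l : Fin r, sympl (generator L l) w = 0) →
      w ∈ symplDual (codeOfColumns L r) := fun w hw c hc => by
    induction hc using Submodule.span_induction with
    | mem x hx => obtain ⟨l, rfl⟩ := hx; exact hw l
    | zero => simp [sympl]
    | add x y _ _ hx hy => rw [sympl_add_left, hx, hy, add_zero]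
    | smul a x _ hx => exact ((symplForm L.length).map_smul₂ a x w).trans (by simp [hx])
  have hvC : v ∉ codeOfColumns L r := fun h => huv (by rw [sympl_comm]; exact hmem u hu v h)
  have hv0 : v ≠ 0 := fun h => hvC (h ▸ Submodule.zero_mem _)
  have hmin : ∀ w ∈ symplDual (codeOfColumns L r), w ≠ 0 → d ≤ wt w := fun w hw hw0 => by
    by_contra! hlt'
    exact maskSyndrome_ne_zero (hdist _ hlt' (Nat.pos_of_ne_zero (mt wt_eq_zero.1 hw0))) rfl
      (maskSyndrome_eq_zero hlt hw)
  have hdual : ∀ l : Fin r, ∃ e : PVec L.length, ∀ m : Fin r,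
      sympl (generator L m) e = if l = m then 1 else 0 := by
    intro l
    obtain ⟨p, hp, h⟩ := hunit l l.2
    obtain ⟨j, hj⟩ := List.get_of_mem hp
    rcases h with h | h
    · refine ⟨(Pi.single j 1, 0), fun m => ?_⟩
      simp [sympl, generator, -List.get_eq_getElem, hj, h, digit_two_pow, Fin.ext_iff,
        CharTwo.neg_eq]
    · refine ⟨(0, Pi.single j 1), fun m => ?_⟩
      simp [sympl, generator, -List.get_eq_getElem, hj, h, digit_two_pow, Fin.ext_iff]
  have hli : LinearIndependent (ZMod 2) fun l : Fin r => generator L l := by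
    rw [Fintype.linearIndependent_iff]
    intro c hc l
    obtain ⟨e, he⟩ := hdual l
    have h := congrArg (fun x => symplForm L.length x e) hc
    simpa [he] using h
  refine ⟨⟨?_, ?_, ⟨v, hmem v hv, hvC, hwt⟩, ?_⟩, ⟨v, hmem v hv, hv0, hwt⟩, ?_⟩
  · exact Submodule.span_le.2 (by rintro _ ⟨l, rfl⟩; exact hmem _ fun m => horth m l)
  · rw [codeOfColumns, finrank_span_eq_card hli, Fintype.card_fin, hk]
  · rintro _ ⟨w, hw, hwC, rfl⟩
    exact hmin w hw fun h => hwC (h ▸ Submodule.zero_mem _)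
  · rintro _ ⟨w, hw, hw0, rfl⟩
    exact hmin w hw hw0

/-- The five pure codes: the code generated by `X⊗⋯⊗X` and `Z⊗⋯⊗Z`; Gottesman's code, in which the
errors `X` and `Z` at the point `u` of `𝔽₂³` have the syndromes `(1, 0, u)` and `(0, 1, Au)` up to a
change of basis, with `A` of order `7`; the twice shortened dodecacode; the shortened quaternary
quadratic residue code of length `17`; the quaternary simplex code, dual to the Hamming code. -/
theorem exists_isPureStabilizerCode {m k d : ℕ} (hrow : (m, k, d) ∈
      ({(5, 3, 2), (7, 2, 3), (9, 1, 4), (15, 1, 6), (20, 14, 3)} : Set (ℕ × ℕ × ℕ))) :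
    ∃ C : Submodule (ZMod 2) (PVec (m + 1)), IsPureStabilizerCode (m + 1) (k + 1) d C := by
  simp only [Set.mem_insert_iff, Set.mem_singleton_iff, Prod.mk.injEq] at hrow
  rcases hrow with ⟨rfl, rfl, rfl⟩ | ⟨rfl, rfl, rfl⟩ | ⟨rfl, rfl, rfl⟩ | ⟨rfl, rfl, rfl⟩ |
    ⟨rfl, rfl, rfl⟩
  · exact ⟨_, isPureStabilizerCode_codeOfColumns (r := 2)
      (L := [(2, 1), (2, 1), (2, 1), (2, 1), (2, 1), (2, 1)])
      (ofMasks _ 0 3) (ofMasks _ 34 0) rfl (by decide +kernel) (by decide +kernel)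
      (by decide +kernel) (by decide +kernel) (by decide +kernel) (by decide +kernel)
      (by decide +kernel) (by decide +kernel)⟩
  · exact ⟨_, isPureStabilizerCode_codeOfColumns (r := 5)
      (L := [(2, 1), (8, 4), (7, 16), (13, 21), (19, 14), (25, 11), (22, 31), (28, 26)])
      (ofMasks _ 0 15) (ofMasks _ 36 40) rfl (by decide +kernel) (by decide +kernel)
      (by decide +kernel) (by decide +kernel) (by decide +kernel) (by decide +kernel)
      (by decide +kernel) (by decide +kernel)⟩
  · exact ⟨_, isPureStabilizerCode_codeOfColumns (r := 8)
      (L := [(2, 1), (8, 4), (32, 16), (58, 64), (81, 128), (197, 139), (29, 164), (119,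
        163), (231, 188), (46, 194)])
      (ofMasks _ 15 4) (ofMasks _ 596 528) rfl (by decide +kernel) (by decide +kernel)
      (by decide +kernel) (by decide +kernel) (by decide +kernel) (by decide +kernel)
      (by decide +kernel) (by decide +kernel)⟩
  · exact ⟨_, isPureStabilizerCode_codeOfColumns (r := 14)
      (L := [(2, 1), (8, 4), (32, 16), (128, 64), (512, 256), (2048, 1024), (8192, 4096),
        (6889, 13719), (7729, 14627), (3410, 3057), (13641, 12231), (14938, 9717), (1557,
        3391), (6231, 13566), (5323, 15494), (9914, 7525)])
      (ofMasks _ 101 337) (ofMasks _ 16906 16576) rfl (by decide +kernel) (by decide +kernel)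
      (by decide +kernel) (by decide +kernel) (by decide +kernel) (by decide +kernel)
      (by decide +kernel) (by decide +kernel)⟩
  · exact ⟨_, isPureStabilizerCode_codeOfColumns (r := 6)
      (L := [(2, 1), (8, 4), (10, 5), (11, 6), (9, 7), (32, 16), (34, 17), (35, 18), (33,
        19), (40, 20), (42, 21), (43, 22), (41, 23), (44, 24), (46, 25), (47, 26), (45, 27),
        (36, 28), (38, 29), (39, 30), (37, 31)])
      (ofMasks _ 0 7) (ofMasks _ 7 0) rfl (by decide +kernel) (by decide +kernel)
      (by decide +kernel) (by decide +kernel) (by decide +kernel) (by decide +kernel)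
      (by decide +kernel) (by decide +kernel)⟩

/-! ### Puncturing a pure code -/

theorem sympl_eq_deleteAt {m : ℕ} (i : Fin (m + 1)) (u v : PVec (m + 1)) :
    sympl u v = (u.1 i * v.2 i + u.2 i * v.1 i) + sympl (deleteAt i u) (deleteAt i v) := by
  rw [sympl_eq_sum, sympl_eq_sum, Fin.sum_univ_succAbove _ i]
  rfl

theorem wt_eq_deleteAt {m : ℕ} (i : Fin (m + 1)) (v : PVec (m + 1)) :
    wt v = (if (v.1 i, v.2 i) ≠ (0, 0) then 1 else 0) + wt (deleteAt i v) := by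
  have hw : ∀ {m : ℕ} (w : PVec m), wt w = ∑ i, if (w.1 i, w.2 i) ≠ (0, 0) then 1 else 0 :=
    fun w => Finset.card_filter _ _
  rw [hw, hw, Fin.sum_univ_succAbove _ i]
  rfl

/-- The component of `(a|b)` at the position `i`. -/
def letterAt {n : ℕ} (i : Fin n) : PVec n →ₗ[ZMod 2] ZMod 2 × ZMod 2 where
  toFun v := (v.1 i, v.2 i)
  map_add' _ _ := rfl
  map_smul' _ _ := rfl

theorem deleteAt_comp_subtype_injective {m k d : ℕ} {C : Submodule (ZMod 2) (PVec (m + 1))}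
    (hC : IsPureStabilizerCode (m + 1) k d C) (hd : 2 ≤ d) (i : Fin (m + 1)) :
    Function.Injective (deleteAt i ∘ₗ C.subtype) := by
  rw [← LinearMap.ker_eq_bot, LinearMap.ker_eq_bot']
  intro c hc
  by_contra hne
  have hwt : d ≤ wt (c : PVec (m + 1)) :=
    hC.pure_dist_eq.2 ⟨c, hC.self_orthogonal c.2, fun h => hne (Subtype.ext h), rfl⟩
  have h0 : wt (deleteAt i (c : PVec (m + 1))) = 0 := wt_eq_zero.2 hc
  rw [wt_eq_deleteAt i, h0] at hwt
  split_ifs at hwt <;> omega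

/-- A functional vanishing on the components at `i` would be a vector of weight one in the dual. -/
theorem range_letterAt_comp_subtype {m k d : ℕ} {C : Submodule (ZMod 2) (PVec (m + 1))}
    (hC : IsPureStabilizerCode (m + 1) k d C) (hd : 2 ≤ d) (i : Fin (m + 1)) :
    LinearMap.range (letterAt i ∘ₗ C.subtype) = ⊤ := by
  by_contra hne
  obtain ⟨f, hf, hle⟩ := Submodule.exists_le_ker_of_lt_top _ (lt_top_iff_ne_top.2 hne)
  have hfx : ∀ x : ZMod 2 × ZMod 2, f x = x.1 * f (1, 0) + x.2 * f (0, 1) := fun x => by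
    have : x = x.1 • (1, 0) + x.2 • (0, 1) := by ext <;> simp
    conv_lhs => rw [this, map_add, map_smul, map_smul, smul_eq_mul, smul_eq_mul]
  set v : PVec (m + 1) := (Pi.single i (f (0, 1)), Pi.single i (f (1, 0))) with hv
  have hdel : deleteAt i v = 0 := by
    ext j <;> simp [deleteAt, hv]
  have hmem : v ∈ symplDual C := fun c hc => by
    rw [sympl_eq_deleteAt i, hdel]
    have h1 : f (c.1 i, c.2 i) = 0 := hle ⟨⟨c, hc⟩, rfl⟩
    rw [hfx] at h1
    simpa [hv, sympl] using h1
  have hv0 : v ≠ 0 := fun h => hf <| LinearMap.ext fun x => by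
    have h1 : f (0, 1) = 0 := by simpa [hv] using congrFun (congrArg Prod.fst h) i
    have h2 : f (1, 0) = 0 := by simpa [hv] using congrFun (congrArg Prod.snd h) i
    rw [hfx, h1, h2]
    simp
  have hwt : d ≤ wt v := hC.pure_dist_eq.2 ⟨v, hmem, hv0, rfl⟩
  rw [wt_eq_deleteAt i, hdel, wt_eq_zero.2 rfl] at hwt
  split_ifs at hwt <;> omega

/-- The form of two punctured vectors of `C` is the form of their components at the position `i`. As
these components take all four values, the radical of the punctured code consists of the punctured
vectors that vanish at `i`, and has codimension two. -/
theorem isEACode_puncture {m k d : ℕ} {C : Submodule (ZMod 2) (PVec (m + 1))}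
    (hC : IsPureStabilizerCode (m + 1) k d C) (hd : 2 ≤ d) (i : Fin (m + 1)) :
    IsEACode m k d 1 (puncture i C) := by
  have hinj := deleteAt_comp_subtype_injective hC hd i
  have hsurj := range_letterAt_comp_subtype hC hd i
  have hD : puncture i C = LinearMap.range (deleteAt i ∘ₗ C.subtype) := by
    rw [LinearMap.range_comp, Submodule.range_subtype, puncture]
  have hdimD : Module.finrank (ZMod 2) (puncture i C) = Module.finrank (ZMod 2) C := by
    rw [hD, LinearMap.finrank_range_of_inj hinj]
  have hrad : (puncture i C ⊓ symplDual (puncture i C) : Submodule (ZMod 2) (PVec m)) =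
      (LinearMap.ker (letterAt i ∘ₗ C.subtype)).map (deleteAt i ∘ₗ C.subtype) := by
    have hform : ∀ a c : C, sympl (deleteAt i (a : PVec (m + 1))) (deleteAt i (c : PVec (m + 1))) =
        a.1.1 i * c.1.2 i + a.1.2 i * c.1.1 i := fun a c => by
      have h := sympl_eq_deleteAt i (a : PVec (m + 1)) c
      rw [hC.self_orthogonal c.2 a a.2] at h
      exact (CharTwo.add_eq_zero.1 h.symm).symm
    ext v
    constructor
    · rintro ⟨⟨c, hc, rfl⟩, hv⟩
      refine ⟨⟨c, hc⟩, ?_, rfl⟩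
      have key : ∀ x : ZMod 2 × ZMod 2, x.1 * c.2 i + x.2 * c.1 i = 0 := fun x => by
        obtain ⟨a, ha⟩ : x ∈ LinearMap.range (letterAt i ∘ₗ C.subtype) := hsurj ▸ trivial
        rw [← ha]
        exact (hform a ⟨c, hc⟩).symm.trans (hv _ ⟨a, a.2, rfl⟩)
      have h1 : c.1 i = 0 := by simpa using key (0, 1)
      have h2 : c.2 i = 0 := by simpa using key (1, 0)
      exact Prod.ext h1 h2
    · rintro ⟨c, hc, rfl⟩
      refine ⟨⟨c, c.2, rfl⟩, ?_⟩
      rintro _ ⟨a, ha, rfl⟩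
      have h1 : c.1.1 i = 0 := congrArg Prod.fst (LinearMap.mem_ker.1 hc)
      have h2 : c.1.2 i = 0 := congrArg Prod.snd (LinearMap.mem_ker.1 hc)
      refine (hform ⟨a, ha⟩ c).trans ?_
      rw [h1, h2, mul_zero, mul_zero, add_zero]
  have hker := LinearMap.finrank_range_add_finrank_ker (letterAt i ∘ₗ C.subtype)
  rw [hsurj, finrank_top, Module.finrank_prod, Module.finrank_self] at hker
  have hmap := ((LinearMap.ker (letterAt i ∘ₗ C.subtype)).equivMapOfInjective _ hinj).finrank_eq
  refine ⟨?_, ?_, ?_⟩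
  · rw [hdimD]
    exact hC.dim_eq
  · rw [hrad, ← hmap, hdimD]
    omega
  · intro v hv hvD
    set w : PVec (m + 1) := (i.insertNth 0 v.1, i.insertNth 0 v.2) with hw
    have hdel : deleteAt i w = v := by
      ext j <;> simp [deleteAt, hw]
    have hwt : wt w = wt v := by
      rw [wt_eq_deleteAt i, hdel]
      simp [hw]
    rw [← hwt]
    refine hC.pure_dist_eq.2 ⟨w, fun c hc => ?_, fun h => hvD ?_, rfl⟩
    · rw [sympl_eq_deleteAt i, hdel, hv _ ⟨c, hc, rfl⟩]
      simp [hw]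
    · rw [← hdel, h, map_zero]
      exact Submodule.zero_mem _

/-! ### Tensor products of one-qubit matrices -/

/-- The tensor product of `n` one-qubit matrices. -/
def tensor {n : ℕ} (A : Fin n → Matrix (ZMod 2) (ZMod 2) ℂ) : Matrix (Bits n) (Bits n) ℂ :=
  Matrix.of fun x y => ∏ j, A j (x j) (y j)

theorem tensor_mul {n : ℕ} (A B : Fin n → Matrix (ZMod 2) (ZMod 2) ℂ) :
    tensor A * tensor B = tensor fun j => A j * B j := by
  ext x y
  simp only [tensor, Matrix.mul_apply, Matrix.of_apply, Finset.prod_univ_sum,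
    Fintype.piFinset_univ, Finset.prod_mul_distrib]

theorem tensor_conjTranspose {n : ℕ} (A : Fin n → Matrix (ZMod 2) (ZMod 2) ℂ) :
    (tensor A)ᴴ = tensor fun j => (A j)ᴴ := by
  ext x y
  simp [tensor, Matrix.conjTranspose_apply]

theorem tensor_smul {n : ℕ} (c : Fin n → ℂ) (A : Fin n → Matrix (ZMod 2) (ZMod 2) ℂ) :
    (tensor fun j => c j • A j) = (∏ j, c j) • tensor A := by
  ext x y
  simp [tensor, Finset.prod_mul_distrib]

theorem trace_tensor {n : ℕ} (A : Fin n → Matrix (ZMod 2) (ZMod 2) ℂ) :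
    (tensor A).trace = ∏ j, (A j).trace := by
  simp only [tensor, Matrix.trace, Matrix.diag, Matrix.of_apply, Finset.prod_univ_sum,
    Fintype.piFinset_univ]

theorem tensor_one (n : ℕ) : tensor (fun _ : Fin n => 1) = 1 := by
  ext x y
  simp [tensor, Matrix.one_apply, Finset.prod_ite_zero, funext_iff]

/-! ### Pauli operators -/

theorem sum_zmod_two {M : Type*} [AddCommMonoid M] (f : ZMod 2 → M) :
    ∑ x, f x = f 0 + f 1 := Fin.sum_univ_two f

theorem zmod_eq_zero_or_one (x : ZMod 2) : x = 0 ∨ x = 1 := by revert x; decide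

theorem pauli₁_zero : pauli₁ 0 0 = 1 := by
  ext x y
  simp [pauli₁, Matrix.one_apply]

theorem pauli₁_conjTranspose (a b : ZMod 2) : (pauli₁ a b)ᴴ = pauli₁ a b := by
  ext x y
  rw [Matrix.conjTranspose_apply]
  obtain rfl | rfl := zmod_eq_zero_or_one a <;> obtain rfl | rfl := zmod_eq_zero_or_one b <;>
  obtain rfl | rfl := zmod_eq_zero_or_one x <;> obtain rfl | rfl := zmod_eq_zero_or_one y <;>
  simp [pauli₁, ZMod.val_one, CharTwo.add_self_eq_zero]

theorem pauli₁_mul_self (a b : ZMod 2) : pauli₁ a b * pauli₁ a b = 1 := by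
  ext x y
  rw [Matrix.mul_apply, sum_zmod_two]
  obtain rfl | rfl := zmod_eq_zero_or_one a <;> obtain rfl | rfl := zmod_eq_zero_or_one b <;>
  obtain rfl | rfl := zmod_eq_zero_or_one x <;> obtain rfl | rfl := zmod_eq_zero_or_one y <;>
  simp [pauli₁, ZMod.val_one, CharTwo.add_self_eq_zero]

theorem pauli₁_mul (a b c d : ZMod 2) :
    ∃ z : ℂ, z ≠ 0 ∧ pauli₁ a b * pauli₁ c d = z • pauli₁ (a + c) (b + d) := by
  refine ⟨Complex.I ^ (a.val * b.val + c.val * d.val) * (-1) ^ (b.val * c.val) /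
    Complex.I ^ ((a + c).val * (b + d).val), by simp, ?_⟩
  ext x y
  rw [Matrix.mul_apply, sum_zmod_two]
  obtain rfl | rfl := zmod_eq_zero_or_one a <;> obtain rfl | rfl := zmod_eq_zero_or_one b <;>
  obtain rfl | rfl := zmod_eq_zero_or_one c <;> obtain rfl | rfl := zmod_eq_zero_or_one d <;>
  obtain rfl | rfl := zmod_eq_zero_or_one x <;> obtain rfl | rfl := zmod_eq_zero_or_one y <;>
  simp [pauli₁, ZMod.val_one, CharTwo.add_self_eq_zero]

theorem pauli₁_mul_comm (a b c d : ZMod 2) :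
    pauli₁ a b * pauli₁ c d = (-1 : ℂ) ^ (a * d + b * c).val • (pauli₁ c d * pauli₁ a b) := by
  ext x y
  rw [Matrix.smul_apply, Matrix.mul_apply, Matrix.mul_apply, sum_zmod_two, sum_zmod_two]
  obtain rfl | rfl := zmod_eq_zero_or_one a <;> obtain rfl | rfl := zmod_eq_zero_or_one b <;>
  obtain rfl | rfl := zmod_eq_zero_or_one c <;> obtain rfl | rfl := zmod_eq_zero_or_one d <;>
  obtain rfl | rfl := zmod_eq_zero_or_one x <;> obtain rfl | rfl := zmod_eq_zero_or_one y <;>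
  simp [pauli₁, ZMod.val_one, CharTwo.add_self_eq_zero]

theorem trace_pauli₁ {a b : ZMod 2} (h : (a, b) ≠ (0, 0)) : (pauli₁ a b).trace = 0 := by
  rw [Matrix.trace, sum_zmod_two]
  obtain rfl | rfl := zmod_eq_zero_or_one a <;> obtain rfl | rfl := zmod_eq_zero_or_one b <;>
  simp_all [pauli₁, ZMod.val_one, CharTwo.add_self_eq_zero]

/-- The Pauli matrices span the one-qubit matrices. -/
theorem eq_sum_pauli₁ (A : Matrix (ZMod 2) (ZMod 2) ℂ) :
    ∃ κ : ZMod 2 × ZMod 2 → ℂ, A = ∑ v, κ v • pauli₁ v.1 v.2 := by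
  refine ⟨fun v => if v = (0, 0) then (A 0 0 + A 1 1) / 2 else if v = (0, 1) then
    (A 0 0 - A 1 1) / 2 else if v = (1, 0) then (A 0 1 + A 1 0) / 2 else
      (A 0 1 - A 1 0) * Complex.I / 2, ?_⟩
  have e1 : (0 : ZMod 2) ≠ 1 := by decide
  ext x y
  rw [Matrix.sum_apply, Fintype.sum_prod_type, sum_zmod_two, sum_zmod_two,
    sum_zmod_two]
  obtain rfl | rfl := zmod_eq_zero_or_one x <;> obtain rfl | rfl := zmod_eq_zero_or_one y <;>
  simp [pauli₁, ZMod.val_one, CharTwo.add_self_eq_zero] <;> ring_nf <;> simp <;> ring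

theorem pauli_eq_tensor {n : ℕ} (v : PVec n) : pauli v = tensor fun j => pauli₁ (v.1 j) (v.2 j) :=
  rfl

theorem pauli_conjTranspose {n : ℕ} (v : PVec n) : (pauli v)ᴴ = pauli v := by
  simp only [pauli_eq_tensor, tensor_conjTranspose, pauli₁_conjTranspose]

theorem pauli_mul_self {n : ℕ} (v : PVec n) : pauli v * pauli v = 1 := by
  simp only [pauli_eq_tensor, tensor_mul, pauli₁_mul_self, tensor_one]

theorem pauli_mul {n : ℕ} (u v : PVec n) :
    ∃ z : ℂ, z ≠ 0 ∧ pauli u * pauli v = z • pauli (u + v) := by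
  choose z hz h using fun j => pauli₁_mul (u.1 j) (u.2 j) (v.1 j) (v.2 j)
  refine ⟨∏ j, z j, Finset.prod_ne_zero_iff.2 fun j _ => hz j, ?_⟩
  simp only [pauli_eq_tensor, tensor_mul, h, tensor_smul]
  rfl

theorem pauli_mul_comm {n : ℕ} (u v : PVec n) :
    pauli u * pauli v = (-1 : ℂ) ^ (sympl u v).val • (pauli v * pauli u) := by
  simp only [pauli_eq_tensor, tensor_mul]
  rw [sympl_eq_sum, neg_one_pow_val_sum, ← tensor_smul]
  exact congrArg tensor (funext fun j => pauli₁_mul_comm _ _ _ _)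

theorem trace_pauli {n : ℕ} {v : PVec n} (hv : v ≠ 0) : (pauli v).trace = 0 := by
  obtain ⟨j, hj⟩ : (supp v).Nonempty := by
    rw [← Finset.card_pos, card_supp, Nat.pos_iff_ne_zero]
    exact mt wt_eq_zero.1 hv
  rw [pauli_eq_tensor, trace_tensor]
  exact Finset.prod_eq_zero (Finset.mem_univ j) (trace_pauli₁ (Finset.mem_filter.1 hj).2)

theorem trace_pauli_mul_pauli {n : ℕ} (u v : PVec n) :
    (pauli u * pauli v).trace = if u = v then 2 ^ n else 0 := by
  split_ifs with h
  · subst h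
    simp [pauli_mul_self, Matrix.trace_one]
  · obtain ⟨z, -, hz⟩ := pauli_mul u v
    rw [hz, Matrix.trace_smul, trace_pauli, smul_zero]
    rwa [Ne, add_eq_zero_iff_eq_neg, ZModModule.neg_eq_self]

/-- The Pauli operator as a unitary. -/
noncomputable def pauliUnitary {n : ℕ} (v : PVec n) : Matrix.unitaryGroup (Bits n) ℂ :=
  ⟨pauli v, by
    rw [Matrix.mem_unitaryGroup_iff, Matrix.star_eq_conjTranspose, pauli_conjTranspose,
      pauli_mul_self]⟩

/-! ### Syndrome projections -/

/-- The product of the spectral projections of the `T i` for the eigenvalues `(-1)^{s_i}`. -/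
noncomputable def jointProj {N : Type*} [Fintype N] [DecidableEq N] {r : ℕ}
    (T : Fin r → Matrix N N ℂ) (s : Bits r) : Matrix N N ℂ :=
  (List.ofFn fun i => (1 / 2 : ℂ) • (1 + (-1 : ℂ) ^ (s i).val • T i)).prod

section jointProj

variable {N : Type*} [Fintype N] [DecidableEq N] {r : ℕ}

theorem jointProj_succ (T : Fin (r + 1) → Matrix N N ℂ) (s : Bits (r + 1)) :
    jointProj T s = (1 / 2 : ℂ) • (1 + (-1 : ℂ) ^ (s 0).val • T 0) *
      jointProj (Fin.tail T) (Fin.tail s) := by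
  rw [jointProj, List.ofFn_succ, List.prod_cons]
  rfl

/-- Moving an operator that commutes up to signs past a joint projection. -/
theorem mul_jointProj {P : Matrix N N ℂ} {T : Fin r → Matrix N N ℂ} {σ : Bits r}
    (h : ∀ i, P * T i = (-1 : ℂ) ^ (σ i).val • (T i * P)) (s : Bits r) :
    P * jointProj T s = jointProj T (s + σ) * P := by
  induction r with
  | zero => simp [jointProj]
  | succ r ih =>
    have h1 := ih (T := Fin.tail T) (σ := Fin.tail σ) (fun i => h i.succ) (Fin.tail s)
    have h0 : P * ((1 / 2 : ℂ) • (1 + (-1 : ℂ) ^ (s 0).val • T 0)) =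
        (1 / 2 : ℂ) • (1 + (-1 : ℂ) ^ ((s + σ) 0).val • T 0) * P := by
      rw [Pi.add_apply, neg_one_pow_val_add]
      simp only [mul_smul_comm, smul_mul_assoc, mul_add, add_mul, mul_one, one_mul, h 0, smul_smul]
    rw [jointProj_succ, jointProj_succ, ← mul_assoc, h0, mul_assoc, h1, mul_assoc]
    rfl

theorem sum_jointProj (T : Fin r → Matrix N N ℂ) : ∑ s, jointProj T s = 1 := by
  induction r with
  | zero => simp [jointProj]
  | succ r ih =>
    rw [← (Fin.consEquiv fun _ => ZMod 2).sum_comp, Fintype.sum_prod_type, sum_zmod_two,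
      ← Finset.sum_add_distrib, ← ih (Fin.tail T)]
    refine Finset.sum_congr rfl fun s _ => ?_
    have h0 : ∀ x : ZMod 2, jointProj T (Fin.consEquiv (fun _ => ZMod 2) (x, s)) =
        (1 / 2 : ℂ) • (1 + (-1 : ℂ) ^ x.val • T 0) * jointProj (Fin.tail T) s :=
      fun x => jointProj_succ T (Fin.cons x s)
    rw [h0, h0, ← add_mul, ZMod.val_zero, ZMod.val_one, ← smul_add]
    convert one_mul (jointProj (Fin.tail T) s) using 2
    module

/-- A joint projection fixes or kills joint eigenvectors. -/
theorem jointProj_mul {M : Type*} {T : Fin r → Matrix N N ℂ} {X : Matrix N M ℂ} {s : Bits r}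
    (h : ∀ i, T i * X = (-1 : ℂ) ^ (s i).val • X) (a : Bits r) :
    jointProj T a * X = if a = s then X else 0 := by
  induction r with
  | zero => simp [jointProj, Subsingleton.elim a s]
  | succ r ih =>
    have h1 := ih (T := Fin.tail T) (s := Fin.tail s) (fun i => h i.succ) (Fin.tail a)
    have hx : ∀ x y : ZMod 2, (-1 : ℂ) ^ x.val * (-1) ^ y.val = if x = y then 1 else -1 := by
      intro x y
      obtain rfl | rfl := zmod_eq_zero_or_one x <;> obtain rfl | rfl := zmod_eq_zero_or_one y <;>
        simp [ZMod.val_one]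
    have h0 : (1 / 2 : ℂ) • (1 + (-1 : ℂ) ^ (a 0).val • T 0) * X = if a 0 = s 0 then X else 0 := by
      rw [Matrix.smul_mul, Matrix.add_mul, Matrix.one_mul, Matrix.smul_mul, h 0, smul_smul, hx]
      split_ifs <;> module
    have ha : a = s ↔ a 0 = s 0 ∧ Fin.tail a = Fin.tail s := by
      refine ⟨by rintro rfl; exact ⟨rfl, rfl⟩, fun ⟨h0, h1⟩ => ?_⟩
      rw [← Fin.cons_self_tail a, ← Fin.cons_self_tail s, h0, h1]
    rw [jointProj_succ, Matrix.mul_assoc, h1]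
    by_cases hs : Fin.tail a = Fin.tail s
    · simp only [hs, if_true, h0, ha, and_true]
    · simp [hs, ha]

theorem mul_jointProj_self {T : Fin r → Matrix N N ℂ} (hsq : ∀ i, T i * T i = 1)
    (hcomm : ∀ i j, T i * T j = T j * T i) (i : Fin r) (s : Bits r) :
    T i * jointProj T s = (-1 : ℂ) ^ (s i).val • jointProj T s := by
  induction r with
  | zero => exact i.elim0
  | succ r ih =>
    rw [jointProj_succ]
    induction i using Fin.cases with
    | zero =>
      have h2 : ((-1 : ℂ) ^ (s 0).val) * (-1) ^ (s 0).val = 1 := by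
        rw [← mul_pow]; simp
      rw [← mul_assoc, ← smul_mul_assoc]
      congr 1
      have h3 : (-1 : ℂ) ^ (s 0).val * (1 / 2 * (-1) ^ (s 0).val) = 1 / 2 := by
        linear_combination (1 / 2 : ℂ) * h2
      rw [mul_smul_comm, mul_add, mul_one, mul_smul_comm, hsq]
      simp only [smul_add, smul_smul, h3]
      rw [add_comm, mul_comm (1 / 2 : ℂ)]
    | succ i =>
      have h1 := ih (T := Fin.tail T) (fun i => hsq _) (fun i j => hcomm _ _) i (Fin.tail s)
      have hc : T i.succ * ((1 / 2 : ℂ) • (1 + (-1 : ℂ) ^ (s 0).val • T 0)) =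
          ((1 / 2 : ℂ) • (1 + (-1 : ℂ) ^ (s 0).val • T 0)) * T i.succ := by
        simp only [mul_smul_comm, smul_mul_assoc, mul_add, add_mul, mul_one, one_mul,
          hcomm i.succ 0]
      rw [← mul_assoc, hc, mul_assoc]
      exact (congrArg _ h1).trans (mul_smul_comm _ _ _)

end jointProj

/-! ### Stabilizer eigenspaces and encoding operators -/

section Syndrome

variable {n r : ℕ} {h : Fin r → PVec n}

theorem pauli_mul_syndromeProj (h : Fin r → PVec n) (v : PVec n) (s : Bits r) :
    pauli v * syndromeProj h s = syndromeProj h (s + syndrome h v) * pauli v :=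
  mul_jointProj (fun i => by rw [pauli_mul_comm, sympl_comm, syndrome_apply]) s

theorem sum_syndromeProj (h : Fin r → PVec n) : ∑ s, syndromeProj h s = 1 :=
  sum_jointProj _

theorem pauli_commute (hh : ∀ i j, sympl (h i) (h j) = 0) (i j : Fin r) :
    pauli (h i) * pauli (h j) = pauli (h j) * pauli (h i) := by
  rw [pauli_mul_comm, hh, ZMod.val_zero, pow_zero, one_smul]

theorem pauli_generator_mul_syndromeProj (hh : ∀ i j, sympl (h i) (h j) = 0) (i : Fin r)
    (s : Bits r) :
    pauli (h i) * syndromeProj h s = (-1 : ℂ) ^ (s i).val • syndromeProj h s :=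
  mul_jointProj_self (fun _ => pauli_mul_self _) (pauli_commute hh) i s

theorem syndromeProj_mul_syndromeProj (hh : ∀ i j, sympl (h i) (h j) = 0) (a s : Bits r) :
    syndromeProj h a * syndromeProj h s = if a = s then syndromeProj h s else 0 :=
  jointProj_mul (fun i => pauli_generator_mul_syndromeProj hh i s) a

theorem syndromeProj_conjTranspose (hh : ∀ i j, sympl (h i) (h j) = 0) (s : Bits r) :
    (syndromeProj h s)ᴴ = syndromeProj h s := by
  -- the adjoint consists of joint eigenvectors as well, so that it is fixed by the projection
  have h1 : ∀ i, pauli (h i) * (syndromeProj h s)ᴴ =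
      (-1 : ℂ) ^ (s i).val • (syndromeProj h s)ᴴ := fun i => by
    have h0 : syndrome h (h i) = 0 := funext fun j => hh j i
    have h2 := pauli_mul_syndromeProj h (h i) s
    rw [h0, add_zero, pauli_generator_mul_syndromeProj hh] at h2
    have h3 := congrArg Matrix.conjTranspose h2
    rw [Matrix.conjTranspose_smul, Matrix.conjTranspose_mul, pauli_conjTranspose] at h3
    rw [← h3, star_pow, star_neg, star_one]
  have h4 : syndromeProj h s * (syndromeProj h s)ᴴ = (syndromeProj h s)ᴴ :=
    (jointProj_mul h1 s).trans (if_pos rfl)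
  have h5 := congrArg Matrix.conjTranspose h4
  rw [Matrix.conjTranspose_mul, Matrix.conjTranspose_conjTranspose] at h5
  rw [← h4, h5]

/-- The Pauli operators permute the eigenspaces transitively, so that all have the same dimension.
-/
theorem trace_syndromeProj (hs : Function.Surjective (syndrome h)) (s : Bits r) :
    (2 : ℂ) ^ r * (syndromeProj h s).trace = 2 ^ n := by
  have h1 : ∀ t, (syndromeProj h t).trace = (syndromeProj h s).trace := fun t => by
    obtain ⟨v, hv⟩ := hs (t - s)
    have h2 := pauli_mul_syndromeProj h v s
    rw [hv, add_sub_cancel] at h2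
    rw [← mul_one (syndromeProj h t), ← pauli_mul_self v, ← mul_assoc, ← h2, Matrix.trace_mul_comm,
      ← mul_assoc, pauli_mul_self, one_mul]
  have h3 := congrArg Matrix.trace (sum_syndromeProj h)
  rw [Matrix.trace_sum, Finset.sum_congr rfl fun t _ => h1 t, Matrix.trace_one] at h3
  simpa using h3

end Syndrome

/-- An idempotent matrix has an orthonormal basis of its range. -/
theorem exists_isometry_of_idempotent {N ι : Type*} [Fintype N] [DecidableEq N] [Fintype ι]
    [DecidableEq ι] {P : Matrix N N ℂ} (hP : P * P = P) (ht : P.trace = Fintype.card ι) :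
    ∃ V : Matrix N ι ℂ, Vᴴ * V = 1 ∧ P * V = V := by
  set f := Matrix.toEuclideanLin P with hf
  have hid : IsIdempotentElem f := by
    change Matrix.toLpLinAlgEquiv (R := ℂ) 2 P * Matrix.toLpLinAlgEquiv (R := ℂ) 2 P = _
    rw [← map_mul, hP]
    rfl
  have hproj := (LinearMap.isProj_range_iff_isIdempotentElem f).2 hid
  have hrank : Module.finrank ℂ (LinearMap.range f) = Fintype.card ι := by
    have h1 := hproj.trace
    rw [hf, Matrix.toEuclideanLin_eq_toLin_orthonormal, Matrix.trace_toLin_eq, ht] at h1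
    exact_mod_cast h1.symm
  set b := (stdOrthonormalBasis ℂ (LinearMap.range f)).reindex
    (Fintype.equivOfCardEq (β := ι) (by rw [Fintype.card_fin, hrank])) with hb
  refine ⟨Matrix.of fun y x => (b x : EuclideanSpace ℂ N) y, ?_, ?_⟩
  · ext x x'
    have h2 := orthonormal_iff_ite.1 b.orthonormal x x'
    rw [Submodule.coe_inner, PiLp.inner_apply] at h2
    rw [Matrix.mul_apply, Matrix.one_apply, ← h2]
    refine Finset.sum_congr rfl fun y _ => ?_
    simp [mul_comm]
  · ext y x
    have h3 := hproj.map_id _ (b x).2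
    exact congrFun (congrArg WithLp.ofLp h3) y

/-- The projection to the ancilla state `a`. -/
def ancillaProj (k : ℕ) {r : ℕ} (a : Bits r) : Matrix (Bits k × Bits r) (Bits k × Bits r) ℂ :=
  Matrix.diagonal fun p => if p.2 = a then 1 else 0

section Encoder

variable {n k r : ℕ} {h : Fin r → PVec n}

theorem exists_isEncoder (hh : ∀ i j, sympl (h i) (h j) = 0)
    (hs : Function.Surjective (syndrome h)) (hn : r + k = n) : ∃ W, IsEncoder k h W := by
  have htr : ∀ s, (syndromeProj h s).trace = Fintype.card (Bits k) := fun s => by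
    have h1 := trace_syndromeProj hs s
    have h2 : (2 : ℂ) ^ n = 2 ^ r * 2 ^ k := by rw [← hn, pow_add]
    rw [h2] at h1
    simpa using mul_left_cancel₀ (pow_ne_zero r (two_ne_zero (α := ℂ))) h1
  have hidem : ∀ s, syndromeProj h s * syndromeProj h s = syndromeProj h s := fun s => by
    rw [syndromeProj_mul_syndromeProj hh, if_pos rfl]
  choose V hV hPV using fun s => exists_isometry_of_idempotent (hidem s) (htr s)
  have horth : ∀ s t, s ≠ t → (V s)ᴴ * V t = 0 := fun s t hst => by
    rw [← hPV s, ← hPV t, Matrix.conjTranspose_mul, syndromeProj_conjTranspose hh,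
      Matrix.mul_assoc, ← Matrix.mul_assoc (syndromeProj h s), syndromeProj_mul_syndromeProj hh,
      if_neg hst, Matrix.zero_mul, Matrix.mul_zero]
  have hW : (Matrix.of fun y (p : Bits k × Bits r) => V p.2 y p.1)ᴴ *
      (Matrix.of fun y (p : Bits k × Bits r) => V p.2 y p.1) = 1 := by
    ext ⟨x, s⟩ ⟨y, t⟩
    change ((V s)ᴴ * V t) x y = _
    by_cases hst : s = t
    · subst hst
      rw [hV, Matrix.one_apply, Matrix.one_apply]
      simp
    · rw [horth s t hst, Matrix.one_apply_ne (by simp [hst])]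
      rfl
  refine ⟨_, hW, ?_, fun x s => ?_⟩
  · refine (Matrix.mul_eq_one_comm_of_card_eq _ _ _ ?_).1 hW
    simp [← hn, pow_add, mul_comm]
  · ext y
    exact congrFun (congrFun (hPV s) y) x

variable {W : Matrix (Bits n) (Bits k × Bits r) ℂ}

theorem IsEncoder.syndromeProj_mul (hh : ∀ i j, sympl (h i) (h j) = 0) (hW : IsEncoder k h W)
    (a : Bits r) : syndromeProj h a * W = W * ancillaProj k a := by
  ext y ⟨x, s⟩
  have h1 : syndromeProj h a *ᵥ (fun y => W y (x, s)) =
      if a = s then fun y => W y (x, s) else 0 := by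
    rw [← hW.mem_eigenspace x s, Matrix.mulVec_mulVec, syndromeProj_mul_syndromeProj hh]
    split_ifs
    · rfl
    · exact Matrix.zero_mulVec _
  rw [ancillaProj, Matrix.mul_diagonal]
  refine (congrFun h1 y).trans ?_
  by_cases hs : a = s <;> simp [hs, eq_comm]

end Encoder

/-! ### The output of the protocol on Pauli errors -/

section Output

variable {n k r : ℕ} {h : Fin r → PVec n} {W : Matrix (Bits n) (Bits k × Bits r) ℂ}

/-- The output of the protocol as a linear function of the input. -/
noncomputable def edpMap (h : Fin r → PVec n) (W : Matrix (Bits n) (Bits k × Bits r) ℂ)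
    (U : Bits r → Matrix.unitaryGroup (Bits n) ℂ) :
    Matrix (Bits n × Bits n) (Bits n × Bits n) ℂ →ₗ[ℂ]
      Matrix (Bits k × Bits k) (Bits k × Bits k) ℂ where
  toFun := edpOutput h W U
  map_add' ρ ρ' := by
    have hadd : ∀ τ τ' : Matrix ((Bits k × Bits r) × (Bits k × Bits r))
        ((Bits k × Bits r) × (Bits k × Bits r)) ℂ,
        discardAncillas (τ + τ') = discardAncillas τ + discardAncillas τ' := fun τ τ' => by
      ext p q
      simp [discardAncillas, Finset.sum_add_distrib]
    simp only [edpOutput, Matrix.mul_add, Matrix.add_mul, hadd, Finset.sum_add_distrib]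
  map_smul' c ρ := by
    have hsmul : ∀ τ : Matrix ((Bits k × Bits r) × (Bits k × Bits r))
        ((Bits k × Bits r) × (Bits k × Bits r)) ℂ,
        discardAncillas (c • τ) = c • discardAncillas τ := fun τ => by
      ext p q
      simp [discardAncillas, Finset.mul_sum]
    simp only [edpOutput, Matrix.mul_smul, Matrix.smul_mul, hsmul, Finset.smul_sum,
      RingHom.id_apply]

theorem edpMap_apply (U : Bits r → Matrix.unitaryGroup (Bits n) ℂ)
    (ρ : Matrix (Bits n × Bits n) (Bits n × Bits n) ℂ) : edpMap h W U ρ = edpOutput h W U ρ := rfl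

/-- Alice's operations on a state `vec M` are moved to Bob's side. -/
theorem branchOp_mulVec_vec (hh : ∀ i j, sympl (h i) (h j) = 0)
    (U : Bits r → Matrix.unitaryGroup (Bits n) ℂ) (a b : Bits r) (M : Matrix (Bits n) (Bits n) ℂ) :
    branchOp h W U a b *ᵥ vec M =
      vec (Wᴴ * (U (a + b) : Matrix (Bits n) (Bits n) ℂ)ᴴ * syndromeProj h b * M *
        (syndromeProj h a * W)) := by
  have h1 : ((W.map star)ᴴ * (syndromeProj h a).map star)ᵀ = syndromeProj h a * W := by
    rw [Matrix.transpose_mul]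
    congr 1
    · exact syndromeProj_conjTranspose hh a
    · ext x y
      simp
  rw [← h1]
  exact Matrix.kronecker_mulVec_vec _ _ _

theorem discardAncillas_vec (X Y : Matrix (Bits k × Bits r) (Bits k × Bits r) ℂ)
    (p q : Bits k × Bits k) :
    discardAncillas (vecMulVec (vec X) (star (vec Y))) p q =
      ∑ a, ∑ b, X (p.2, b) (p.1, a) * star (Y (q.2, b) (q.1, a)) := rfl

/-- Error and correction, as seen through the encoding operator. -/
noncomputable def correctedError (h : Fin r → PVec n) (W : Matrix (Bits n) (Bits k × Bits r) ℂ)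
    (U : Bits r → Matrix.unitaryGroup (Bits n) ℂ) (u : PVec n) :
    Matrix (Bits k × Bits r) (Bits k × Bits r) ℂ :=
  Wᴴ * (U (syndrome h u) : Matrix (Bits n) (Bits n) ℂ)ᴴ * pauli u * W

/-- On the error `u`, only those outcomes occur whose sum is the syndrome of `u`. -/
theorem branch_pauli (hh : ∀ i j, sympl (h i) (h j) = 0) (hW : IsEncoder k h W)
    (U : Bits r → Matrix.unitaryGroup (Bits n) ℂ) (a b : Bits r) (u : PVec n) :
    Wᴴ * (U (a + b) : Matrix (Bits n) (Bits n) ℂ)ᴴ * syndromeProj h b * pauli u *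
        (syndromeProj h a * W) =
      if a + b = syndrome h u then correctedError h W U u * ancillaProj k a else 0 := by
  have h1 : syndromeProj h b * pauli u * (syndromeProj h a * W) =
      if a + b = syndrome h u then pauli u * (syndromeProj h a * W) else 0 := by
    have h2 : a + b = syndrome h u ↔ b = a + syndrome h u := by
      constructor
      · rintro h3
        rw [← h3, ← add_assoc, ZModModule.add_self, zero_add]
      · rintro rfl
        rw [← add_assoc, ZModModule.add_self, zero_add]
    rw [Matrix.mul_assoc, ← Matrix.mul_assoc (pauli u), pauli_mul_syndromeProj,
      ← Matrix.mul_assoc, ← Matrix.mul_assoc, syndromeProj_mul_syndromeProj hh]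
    simp only [h2]
    split_ifs
    · rfl
    · rw [Matrix.zero_mul, Matrix.zero_mul]
  rw [Matrix.mul_assoc _ (syndromeProj h b), Matrix.mul_assoc, h1]
  split_ifs with h3
  · rw [hW.syndromeProj_mul hh, correctedError, h3]
    simp only [Matrix.mul_assoc]
  · exact Matrix.mul_zero _

theorem edpOutput_vecMulVec_pauli (hh : ∀ i j, sympl (h i) (h j) = 0) (hW : IsEncoder k h W)
    (U : Bits r → Matrix.unitaryGroup (Bits n) ℂ) (u v : PVec n) (p q : Bits k × Bits k) :
    edpOutput h W U (vecMulVec (vec (pauli u)) (star (vec (pauli v)))) p q =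
      if syndrome h u = syndrome h v then
        ∑ a, ∑ b, correctedError h W U u (p.2, b) (p.1, a) *
          star (correctedError h W U v (q.2, b) (q.1, a))
      else 0 := by
  have hterm : ∀ a b : Bits r,
      discardAncillas (branchOp h W U a b * vecMulVec (vec (pauli u)) (star (vec (pauli v))) *
        (branchOp h W U a b)ᴴ) p q =
      if a + b = syndrome h u ∧ a + b = syndrome h v then
        ∑ b', correctedError h W U u (p.2, b') (p.1, a) *
          star (correctedError h W U v (q.2, b') (q.1, a)) else 0 := by
    intro a b
    rw [Matrix.mul_vecMulVec, Matrix.vecMulVec_mul, ← Matrix.star_mulVec, branchOp_mulVec_vec hh,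
      branchOp_mulVec_vec hh, branch_pauli hh hW, branch_pauli hh hW, discardAncillas_vec]
    by_cases h1 : a + b = syndrome h u
    · by_cases h2 : a + b = syndrome h v
      · rw [if_pos h1, if_pos h2, if_pos ⟨h1, h2⟩, Finset.sum_eq_single a]
        · simp [ancillaProj, Matrix.mul_diagonal]
        · intro c _ hc
          simp [ancillaProj, Matrix.mul_diagonal, hc]
        · simp
      · simp [h2]
    · simp [h1]
  simp only [edpOutput, Matrix.sum_apply, hterm]
  split_ifs with huv
  · refine Finset.sum_congr rfl fun a _ => ?_
    rw [Finset.sum_eq_single (syndrome h u - a)]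
    · rw [if_pos ⟨by abel, by rw [← huv]; abel⟩]
    · intro b _ hb
      rw [if_neg fun h1 => hb (eq_sub_of_add_eq' h1.1)]
    · simp
  · refine Finset.sum_eq_zero fun a _ => Finset.sum_eq_zero fun b _ => ?_
    rw [if_neg fun h1 => huv (h1.1.symm.trans h1.2)]

end Output

/-! ### States of the pairs -/

theorem sqrt_two_inv_mul_self :
    (1 / (Real.sqrt 2 : ℂ)) * star (1 / (Real.sqrt 2 : ℂ)) = 1 / 2 := by
  rw [Complex.star_def, map_div₀, map_one, Complex.conj_ofReal, div_mul_div_comm, one_mul,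
    ← Complex.ofReal_mul, Real.mul_self_sqrt zero_le_two, Complex.ofReal_ofNat]

theorem psi_mul_star_psi (x y x' y' : ZMod 2) :
    psi x y * star (psi x' y') = if x = y ∧ x' = y' then 1 / 2 else 0 := by
  by_cases h1 : x = y <;> by_cases h2 : x' = y' <;> simp only [psi, h1, h2, if_true, if_false,
    and_true, and_false, star_zero, zero_mul, mul_zero, sqrt_two_inv_mul_self, and_self]

theorem maxEnt_apply (k : ℕ) (p q : Bits k × Bits k) :
    maxEnt k p q = if p.1 = p.2 ∧ q.1 = q.2 then (1 / 2) ^ k else 0 := by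
  simp only [maxEnt, Matrix.of_apply, psi_mul_star_psi, Finset.prod_ite_zero, Finset.mem_univ,
    true_implies, Finset.prod_const, Finset.card_univ, Fintype.card_fin, funext_iff, forall_and]

/-- The span of the Pauli operators acting at the positions in `S`. -/
noncomputable def pauliSpan {n : ℕ} (S : Finset (Fin n)) :
    Submodule ℂ (Matrix (Bits n) (Bits n) ℂ) :=
  Submodule.span ℂ (pauli '' {v | supp v ⊆ S})

theorem tensor_mem_pauliSpan {n : ℕ} {S : Finset (Fin n)}
    {A : Fin n → Matrix (ZMod 2) (ZMod 2) ℂ} (hA : ∀ j ∉ S, ∃ c : ℂ, A j = c • 1) :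
    tensor A ∈ pauliSpan S := by
  have hκ : ∀ j, ∃ κ : ZMod 2 × ZMod 2 → ℂ, A j = ∑ v, κ v • pauli₁ v.1 v.2 ∧
      (j ∉ S → ∀ v ≠ 0, κ v = 0) := by
    intro j
    by_cases hj : j ∈ S
    · obtain ⟨κ, hκ⟩ := eq_sum_pauli₁ (A j)
      exact ⟨κ, hκ, fun h => absurd hj h⟩
    · obtain ⟨c, hc⟩ := hA j hj
      refine ⟨fun v => if v = 0 then c else 0, ?_, fun _ v hv => if_neg hv⟩
      rw [Finset.sum_eq_single 0 (fun v _ hv => by simp [hv]) (by simp), hc]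
      simp [pauli₁_zero]
  choose κ hκ hκ0 using hκ
  have hexp : tensor A = ∑ f : Fin n → ZMod 2 × ZMod 2,
      (∏ j, κ j (f j)) • pauli (fun j => (f j).1, fun j => (f j).2) := by
    ext x y
    simp only [tensor, hκ, Matrix.of_apply, Matrix.sum_apply, Matrix.smul_apply,
      Finset.prod_univ_sum, Fintype.piFinset_univ, smul_eq_mul, pauli, Finset.prod_mul_distrib]
  rw [hexp]
  refine Submodule.sum_mem _ fun f _ => ?_
  by_cases hf : ∀ j ∉ S, f j = 0
  · refine Submodule.smul_mem _ _ (Submodule.subset_span ⟨_, fun j hj => ?_, rfl⟩)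
    by_contra hjS
    exact absurd hj (notMem_supp.2 ⟨congrArg Prod.fst (hf j hjS), congrArg Prod.snd (hf j hjS)⟩)
  · push Not at hf
    obtain ⟨j, hjS, hj⟩ := hf
    rw [Finset.prod_eq_zero (Finset.mem_univ j) (hκ0 j hjS _ hj), zero_smul]
    exact Submodule.zero_mem _

/-- The operator `M` for which `vec M` is the basis state `p` of the pairs in `S`, with all other
pairs in the state `|Ψ⟩`. -/
noncomputable def pairUnit {n : ℕ} (S : Finset (Fin n)) (p : (S → ZMod 2) × (S → ZMod 2)) :
    Matrix (Bits n) (Bits n) ℂ :=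
  tensor fun j => if hj : j ∈ S then Matrix.single (p.2 ⟨j, hj⟩) (p.1 ⟨j, hj⟩) 1
    else (1 / (Real.sqrt 2 : ℂ)) • 1

theorem pairUnit_mem_pauliSpan {n : ℕ} (S : Finset (Fin n)) (p : (S → ZMod 2) × (S → ZMod 2)) :
    pairUnit S p ∈ pauliSpan S :=
  tensor_mem_pauliSpan fun _ hj => ⟨_, dif_neg hj⟩

theorem trace_pairUnit {n : ℕ} (S : Finset (Fin n)) (p q : (S → ZMod 2) × (S → ZMod 2)) :
    ((pairUnit S q)ᴴ * pairUnit S p).trace = if p = q then 1 else 0 := by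
  rw [pairUnit, pairUnit, tensor_conjTranspose, tensor_mul, trace_tensor,
    ← Finset.prod_mul_prod_compl S, ← Finset.prod_coe_sort S]
  have h1 : ∀ j : S, ((if hj : (j : Fin n) ∈ S then Matrix.single (q.2 ⟨j, hj⟩) (q.1 ⟨j, hj⟩) 1
      else (1 / (Real.sqrt 2 : ℂ)) • (1 : Matrix (ZMod 2) (ZMod 2) ℂ))ᴴ *
      (if hj : (j : Fin n) ∈ S then Matrix.single (p.2 ⟨j, hj⟩) (p.1 ⟨j, hj⟩) 1
      else (1 / (Real.sqrt 2 : ℂ)) • 1)).trace =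
      if p.1 j = q.1 j ∧ p.2 j = q.2 j then 1 else 0 := by
    intro j
    rw [dif_pos j.2, dif_pos j.2, Matrix.conjTranspose_single, star_one]
    by_cases h2 : p.2 j = q.2 j
    · rw [h2, Matrix.single_mul_single_same, mul_one]
      by_cases h1 : p.1 j = q.1 j
      · simp [h1]
      · simp [h1, Matrix.trace_single_eq_of_ne, Ne.symm h1]
    · rw [Matrix.single_mul_single_of_ne _ _ _ _ (Ne.symm h2)]
      simp [h2]
  have h2 : ∏ j ∈ Sᶜ, ((if hj : (j : Fin n) ∈ S then
      Matrix.single (q.2 ⟨j, hj⟩) (q.1 ⟨j, hj⟩) 1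
      else (1 / (Real.sqrt 2 : ℂ)) • (1 : Matrix (ZMod 2) (ZMod 2) ℂ))ᴴ *
      (if hj : (j : Fin n) ∈ S then Matrix.single (p.2 ⟨j, hj⟩) (p.1 ⟨j, hj⟩) 1
      else (1 / (Real.sqrt 2 : ℂ)) • 1)).trace = 1 := by
    refine Finset.prod_eq_one fun j hj => ?_
    rw [dif_neg (Finset.mem_compl.1 hj), dif_neg (Finset.mem_compl.1 hj),
      Matrix.conjTranspose_smul, Matrix.conjTranspose_one, Matrix.smul_mul, Matrix.mul_smul,
      Matrix.one_mul, smul_smul, mul_comm, sqrt_two_inv_mul_self, Matrix.trace_smul,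
      Matrix.trace_one]
    simp
  rw [h2, mul_one, Finset.prod_congr rfl fun j _ => h1 j, Finset.prod_ite_zero]
  simp only [Prod.ext_iff, funext_iff, forall_and, Finset.mem_univ, true_implies,
    Finset.prod_const_one]

theorem pairState_eq_sum {n : ℕ} (S : Finset (Fin n))
    (σ : Matrix ((S → ZMod 2) × (S → ZMod 2)) ((S → ZMod 2) × (S → ZMod 2)) ℂ) :
    pairState S σ =
      ∑ p, ∑ q, σ p q • vecMulVec (vec (pairUnit S p)) (star (vec (pairUnit S q))) := by
  have hunit : ∀ p (x y : Bits n), pairUnit S p y x =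
      if p = (fun j : S => x j, fun j : S => y j) then ∏ j ∈ Sᶜ, psi (x j) (y j) else 0 := by
    intro p x y
    rw [pairUnit, tensor, Matrix.of_apply, ← Finset.prod_mul_prod_compl S,
      ← Finset.prod_coe_sort S]
    have h1 : ∀ j : S, (if hj : (j : Fin n) ∈ S then Matrix.single (p.2 ⟨j, hj⟩) (p.1 ⟨j, hj⟩) 1
        else (1 / (Real.sqrt 2 : ℂ)) • (1 : Matrix (ZMod 2) (ZMod 2) ℂ)) (y j) (x j) =
        if p.1 j = x j ∧ p.2 j = y j then 1 else 0 := by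
      intro j
      rw [dif_pos j.2, Matrix.single_apply]
      simp only [and_comm]
    have h2 : ∀ j ∈ Sᶜ, (if hj : (j : Fin n) ∈ S then
        Matrix.single (p.2 ⟨j, hj⟩) (p.1 ⟨j, hj⟩) 1
        else (1 / (Real.sqrt 2 : ℂ)) • (1 : Matrix (ZMod 2) (ZMod 2) ℂ)) (y j) (x j) =
        psi (x j) (y j) := by
      intro j hj
      rw [dif_neg (Finset.mem_compl.1 hj), Matrix.smul_apply, Matrix.one_apply, psi]
      simp [eq_comm]
    rw [Finset.prod_congr rfl fun j _ => h1 j, Finset.prod_congr rfl h2, Finset.prod_ite_zero]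
    simp [Prod.ext_iff, funext_iff, forall_and]
  ext ⟨x, y⟩ ⟨x', y'⟩
  simp only [Matrix.sum_apply, Matrix.smul_apply, vecMulVec_apply, Pi.star_apply, vec, hunit,
    smul_eq_mul]
  rw [Finset.sum_eq_single (fun j : S => x j, fun j : S => y j)
    (fun p _ hp => by simp [hp]) (by simp),
    Finset.sum_eq_single (fun j : S => x' j, fun j : S => y' j)
    (fun p _ hp => by simp [hp]) (by simp), if_pos rfl, if_pos rfl, star_prod,
    ← Finset.prod_mul_distrib]
  rfl

/-! ### Correct decoding -/

section Correct

variable {n k r : ℕ} {h : Fin r → PVec n} {W : Matrix (Bits n) (Bits k × Bits r) ℂ}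

/-- If the decoder identifies all Pauli errors at the positions in `S` from their syndromes, then it
corrects every joint state of the pairs in `S`: in the expansion of the state into Bell states, the
measurement of the syndromes removes all terms which are not on the diagonal. -/
theorem edpOutput_pairState (hn : r + k = n) (hh : ∀ i j, sympl (h i) (h j) = 0)
    (hW : IsEncoder k h W) {w : Bits r → PVec n} {S : Finset (Fin n)}
    (hw : ∀ v, supp v ⊆ S → w (syndrome h v) = v)
    (σ : Matrix ((S → ZMod 2) × (S → ZMod 2)) ((S → ZMod 2) × (S → ZMod 2)) ℂ) :
    edpOutput h W (fun s => pauliUnitary (w s)) (pairState S σ) = σ.trace • maxEnt k := by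
  set U : Bits r → Matrix.unitaryGroup (Bits n) ℂ := fun s => pauliUnitary (w s) with hU
  have hone : ∀ v, supp v ⊆ S → correctedError h W U v = 1 := fun v hv => by
    have h1 : (U (syndrome h v) : Matrix (Bits n) (Bits n) ℂ) = pauli v :=
      congrArg pauli (hw v hv)
    rw [correctedError, h1, pauli_conjTranspose, Matrix.mul_assoc Wᴴ, pauli_mul_self,
      Matrix.mul_one, hW.conjTranspose_mul_self]
  have hpauli : ∀ u v, supp u ⊆ S → supp v ⊆ S →
      edpOutput h W U (vecMulVec (vec (pauli u)) (star (vec (pauli v)))) =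
        ((pauli v)ᴴ * pauli u).trace • maxEnt k := by
    intro u v hu hv
    ext p q
    rw [edpOutput_vecMulVec_pauli hh hW, hone u hu, hone v hv, pauli_conjTranspose,
      trace_pauli_mul_pauli, Matrix.smul_apply, maxEnt_apply]
    by_cases huv : u = v
    · have h2 : ∀ a b : Bits r, (1 : Matrix (Bits k × Bits r) (Bits k × Bits r) ℂ) (p.2, b) (p.1, a)
          * star ((1 : Matrix (Bits k × Bits r) (Bits k × Bits r) ℂ) (q.2, b) (q.1, a)) =
          if b = a then (if p.1 = p.2 ∧ q.1 = q.2 then 1 else 0) else 0 := by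
        intro a b
        simp only [Matrix.one_apply, Prod.mk.injEq, eq_comm (a := p.2), eq_comm (a := q.2)]
        by_cases h3 : b = a <;> by_cases h4 : p.1 = p.2 <;> by_cases h5 : q.1 = q.2 <;>
          simp [h3, h4, h5]
      have h3 : (2 : ℂ) ^ n * (1 / 2) ^ k = 2 ^ r := by
        rw [← hn, pow_add, mul_assoc, ← mul_pow]
        norm_num
      rw [if_pos (congrArg _ huv), if_pos huv.symm]
      simp only [h2, Finset.sum_ite_eq', Finset.mem_univ, if_true, Finset.sum_const]
      rw [smul_eq_mul, mul_ite, mul_zero, h3]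
      simp
    · rw [if_neg fun hs => huv (by rw [← hw u hu, hs, hw v hv]), if_neg (Ne.symm huv), zero_smul]
  have hspan : ∀ M ∈ pauliSpan S, ∀ N ∈ pauliSpan S,
      edpMap h W U (vecMulVec (vec M) (star (vec N))) = (Nᴴ * M).trace • maxEnt k := by
    intro M hM N hN
    induction hM using Submodule.span_induction with
    | mem x hx =>
      obtain ⟨u, hu, rfl⟩ := hx
      induction hN using Submodule.span_induction with
      | mem y hy =>
        obtain ⟨v, hv, rfl⟩ := hy
        exact hpauli u v hu hv
      | zero => simp
      | add y y' _ _ h1 h2 =>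
        rw [vec_add, star_add, vecMulVec_add, map_add, h1, h2, conjTranspose_add, Matrix.add_mul,
          trace_add, add_smul]
      | smul c y _ h1 =>
        rw [vec_smul, star_smul, vecMulVec_smul, map_smul, h1, conjTranspose_smul,
          Matrix.smul_mul, trace_smul, smul_assoc]
    | zero => simp
    | add x x' _ _ h1 h2 =>
      rw [vec_add, add_vecMulVec, map_add, h1, h2, Matrix.mul_add, trace_add, add_smul]
    | smul c x _ h1 =>
      rw [vec_smul, smul_vecMulVec, map_smul, h1, Matrix.mul_smul, trace_smul, smul_assoc]
  rw [← edpMap_apply, pairState_eq_sum, map_sum, Matrix.trace, Finset.sum_smul]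
  refine Finset.sum_congr rfl fun p _ => ?_
  rw [map_sum, Finset.sum_eq_single p]
  · rw [map_smul, hspan _ (pairUnit_mem_pauliSpan S p) _ (pairUnit_mem_pauliSpan S p),
      trace_pairUnit, if_pos rfl, one_smul]
    rfl
  · intro q _ hq
    rw [map_smul, hspan _ (pairUnit_mem_pauliSpan S p) _ (pairUnit_mem_pauliSpan S q),
      trace_pairUnit, if_neg (Ne.symm hq), zero_smul, smul_zero]
  · simp

end Correct

/-! ### The decoder of the breeding protocol -/

/-- The decoder chooses an error with the given syndrome that has the fewest nonzero components
outside of the erased positions. Two such candidates differ by a vector of the dual code of weight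
less than `d`, which vanishes by purity. -/
theorem exists_decoder {n k d r : ℕ} {C : Submodule (ZMod 2) (PVec n)}
    (hC : IsPureStabilizerCode n k d C) (h : Module.Basis (Fin r) (ZMod 2) C) :
    ∃ U : Finset (Fin n) → Bits r → Matrix.unitaryGroup (Bits n) ℂ,
      ∀ W : Matrix (Bits n) (Bits k × Bits r) ℂ, IsEncoder k (fun j => (h j : PVec n)) W →
        ∀ t e : ℕ, 2 * t + e < d → ∀ P : Finset (Fin n),
          EDPCorrects P (fun j => (h j : PVec n)) W U t e := by
  set g : Fin r → PVec n := fun j => (h j : PVec n) with hg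
  have hn : r + k = n := by
    rw [← hC.dim_eq, Module.finrank_eq_card_basis h, Fintype.card_fin]
  have hh : ∀ i j, sympl (g i) (g j) = 0 := fun i j => hC.self_orthogonal (h j).2 _ (h i).2
  have hdec : ∀ (E : Finset (Fin n)) (s : Bits r), ∃ w : PVec n, syndrome g w = s ∧
      ∀ v, syndrome g v = s → (supp w \ E).card ≤ (supp v \ E).card := by
    intro E s
    obtain ⟨v, hv⟩ := syndrome_surjective h s
    obtain ⟨w, hw, hmin⟩ := Finset.exists_min_image
      (Finset.univ.filter fun v => syndrome g v = s) (fun v => (supp v \ E).card) ⟨v, by simpa⟩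
    exact ⟨w, by simpa using hw, fun v hv => hmin v (by simpa using hv)⟩
  choose w hws hwmin using hdec
  refine ⟨fun E s => pauliUnitary (w E s), fun W hW t e hte P T E hT hE _ σ _ hσ => ?_⟩
  rw [edpOutput_pairState hn hh hW (w := w E) ?_ σ, hσ, one_smul]
  intro v hv
  set u := w E (syndrome g v) with hu
  have hdual : u + v ∈ symplDual C := by
    rw [← syndrome_eq_zero_iff h, map_add, hws E, ZModModule.add_self]
  have hvT : (supp v \ E).card ≤ t := by
    refine (Finset.card_le_card fun i hi => ?_).trans hT
    rw [Finset.mem_sdiff] at hi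
    exact (Finset.mem_union.1 (hv hi.1)).resolve_right hi.2
  have huT : (supp u \ E).card ≤ t := (hwmin E _ v rfl).trans hvT
  have hwt : wt (u + v) ≤ 2 * t + e := by
    have hsub : supp (u + v) ⊆ (supp u \ E) ∪ (supp v \ E) ∪ E := fun i hi => by
      have := supp_add_subset u v hi
      simp only [Finset.mem_union, Finset.mem_sdiff] at this ⊢
      tauto
    have h1 := Finset.card_le_card hsub
    have h2 := Finset.card_union_le ((supp u \ E) ∪ (supp v \ E)) E
    have h3 := Finset.card_union_le (supp u \ E) (supp v \ E)
    rw [card_supp] at h1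
    omega
  have h0 : u + v = 0 := by
    by_contra hne
    have := hC.pure_dist_eq.2 ⟨u + v, hdual, hne, rfl⟩
    omega
  rw [add_eq_zero_iff_eq_neg.1 h0, ZModModule.neg_eq_self]

/-! ### The limits of the hashing protocol -/

/-- The amplitudes of the Bell state of the pairs in `S` that belongs to the Pauli error `v`. -/
noncomputable def bellState {n : ℕ} (S : Finset (Fin n)) (v : PVec n) :
    (S → ZMod 2) × (S → ZMod 2) → ℂ :=
  fun p => ∏ j : S, (1 / (Real.sqrt 2 : ℂ)) * pauli₁ (v.1 j) (v.2 j) (p.2 j) (p.1 j)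

theorem trace_bellState {n : ℕ} (S : Finset (Fin n)) (v : PVec n) :
    (vecMulVec (bellState S v) (star (bellState S v))).trace = 1 := by
  have hloc : ∀ a b : ZMod 2, ∑ x, ∑ y, (1 / (Real.sqrt 2 : ℂ) * pauli₁ a b y x) *
      star (1 / (Real.sqrt 2 : ℂ) * pauli₁ a b y x) = 1 := by
    intro a b
    have h1 : ∀ z : ℂ, (1 / (Real.sqrt 2 : ℂ) * z) * star (1 / (Real.sqrt 2 : ℂ) * z) =
        1 / 2 * (z * star z) := fun z => by
      rw [← sqrt_two_inv_mul_self, star_mul']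
      ring
    simp only [h1, sum_zmod_two]
    obtain rfl | rfl := zmod_eq_zero_or_one a <;> obtain rfl | rfl := zmod_eq_zero_or_one b <;>
      simp [pauli₁, ZMod.val_one, CharTwo.add_self_eq_zero] <;> norm_num
  simp only [Matrix.trace, Matrix.diag, vecMulVec_apply, Pi.star_apply, bellState, star_prod,
    ← Finset.prod_mul_distrib]
  rw [Fintype.sum_prod_type]
  have h2 : ∀ x : S → ZMod 2, ∑ y : S → ZMod 2, ∏ j : S,
      (1 / (Real.sqrt 2 : ℂ) * pauli₁ (v.1 j) (v.2 j) (y j) (x j)) *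
        star (1 / (Real.sqrt 2 : ℂ) * pauli₁ (v.1 j) (v.2 j) (y j) (x j)) =
      ∏ j : S, ∑ y, (1 / (Real.sqrt 2 : ℂ) * pauli₁ (v.1 j) (v.2 j) y (x j)) *
        star (1 / (Real.sqrt 2 : ℂ) * pauli₁ (v.1 j) (v.2 j) y (x j)) := fun x => by
    rw [Finset.prod_univ_sum, Fintype.piFinset_univ]
  simp only [h2]
  have h3 := Finset.prod_univ_sum (fun _ : S => (Finset.univ : Finset (ZMod 2)))
    fun j x => ∑ y, (1 / (Real.sqrt 2 : ℂ) * pauli₁ (v.1 j) (v.2 j) y x) *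
        star (1 / (Real.sqrt 2 : ℂ) * pauli₁ (v.1 j) (v.2 j) y x)
  rw [Fintype.piFinset_univ] at h3
  rw [← h3]
  exact Finset.prod_eq_one fun j _ => hloc _ _

theorem pairState_bellState {n : ℕ} {S : Finset (Fin n)} {v : PVec n} (hv : supp v ⊆ S) :
    pairState S (vecMulVec (bellState S v) (star (bellState S v))) =
      (1 / 2 : ℂ) ^ n • vecMulVec (vec (pauli v)) (star (vec (pauli v))) := by
  have hamp : ∀ x y : Bits n, bellState S v (fun j => x j, fun j => y j) *
      ∏ j ∈ Sᶜ, psi (x j) (y j) = (1 / (Real.sqrt 2 : ℂ)) ^ n * pauli v y x := by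
    intro x y
    have h1 : ∀ j ∈ Sᶜ, psi (x j) (y j) =
        (1 / (Real.sqrt 2 : ℂ)) * pauli₁ (v.1 j) (v.2 j) (y j) (x j) := by
      intro j hj
      obtain ⟨h2, h3⟩ := notMem_supp.1 fun h => Finset.mem_compl.1 hj (hv h)
      rw [h2, h3, pauli₁_zero, Matrix.one_apply, psi]
      simp [eq_comm]
    rw [Finset.prod_congr rfl h1, bellState,
      Finset.prod_coe_sort S fun j =>
        (1 / (Real.sqrt 2 : ℂ)) * pauli₁ (v.1 j) (v.2 j) (y j) (x j),
      Finset.prod_mul_prod_compl, Finset.prod_mul_distrib, Finset.prod_const, Finset.card_univ,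
      Fintype.card_fin]
    rfl
  ext ⟨x, y⟩ ⟨x', y'⟩
  have h4 : pairState S (vecMulVec (bellState S v) (star (bellState S v))) (x, y) (x', y') =
      (bellState S v (fun j => x j, fun j => y j) * ∏ j ∈ Sᶜ, psi (x j) (y j)) *
      star (bellState S v (fun j => x' j, fun j => y' j) * ∏ j ∈ Sᶜ, psi (x' j) (y' j)) := by
    rw [star_mul', star_prod, mul_mul_mul_comm, ← Finset.prod_mul_distrib]
    rfl
  rw [h4, hamp, hamp, star_mul', star_pow, mul_mul_mul_comm, ← mul_pow, sqrt_two_inv_mul_self]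
  rfl

section Hashing

variable {n k r : ℕ} {h : Fin r → PVec n} {W : Matrix (Bits n) (Bits k × Bits r) ℂ}

/-- If the protocol turns the Bell state of `v` into `|Ψ⟩^{⊗k}`, then error and correction together
act on the ancilla qubits only. -/
theorem exists_correctedError_eq (hh : ∀ i j, sympl (h i) (h j) = 0)
    (hW : IsEncoder k h W) (U : Bits r → Matrix.unitaryGroup (Bits n) ℂ) {v : PVec n}
    {S : Finset (Fin n)} (hv : supp v ⊆ S)
    (hout : edpOutput h W U (pairState S (vecMulVec (bellState S v) (star (bellState S v)))) =
      maxEnt k) :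
    ∃ L : Matrix (Bits r) (Bits r) ℂ,
      correctedError h W U v = Matrix.kroneckerMap (· * ·) (1 : Matrix (Bits k) (Bits k) ℂ) L := by
  set Y := correctedError h W U v with hY
  set f : Bits k → Bits k → Bits r × Bits r → ℂ := fun x y c => Y (y, c.2) (x, c.1) with hf
  have hdot : ∀ x y x' y', f x y ⬝ᵥ star (f x' y') =
      if x = y ∧ x' = y' then (2 : ℂ) ^ n * (1 / 2) ^ k else 0 := by
    intro x y x' y'
    rw [pairState_bellState hv, ← edpMap_apply, map_smul, edpMap_apply] at hout
    have h1 := congrFun (congrFun hout (x, y)) (x', y')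
    rw [Matrix.smul_apply, edpOutput_vecMulVec_pauli hh hW, if_pos rfl, maxEnt_apply,
      smul_eq_mul] at h1
    have h2 : f x y ⬝ᵥ star (f x' y') =
        ∑ a, ∑ b, Y (y, b) (x, a) * star (Y (y', b) (x', a)) := Fintype.sum_prod_type _
    have h3 : (2 : ℂ) ^ n * (1 / 2) ^ n = 1 := by
      rw [← mul_pow]; norm_num
    rw [h2, ← mul_ite_zero]
    exact (by rw [← mul_assoc, h3, one_mul] : _ = (2 : ℂ) ^ n * ((1 / 2) ^ n *
      ∑ a, ∑ b, Y (y, b) (x, a) * star (Y (y', b) (x', a)))).trans (congrArg _ h1)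
  have hoff : ∀ x y, x ≠ y → f x y = 0 := fun x y hxy => by
    rw [← dotProduct_self_star_eq_zero, hdot, if_neg fun h => hxy h.1]
  have hdiag : ∀ x y, f x x = f y y := fun x y => by
    rw [← sub_eq_zero, ← dotProduct_self_star_eq_zero, star_sub, sub_dotProduct,
      dotProduct_sub, dotProduct_sub]
    simp [hdot]
  refine ⟨Matrix.of fun b a => f 0 0 (a, b), ?_⟩
  ext ⟨y, b⟩ ⟨x, a⟩
  change f x y (a, b) = (1 : Matrix (Bits k) (Bits k) ℂ) y x * f 0 0 (a, b)
  by_cases hxy : y = x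
  · rw [hxy, Matrix.one_apply_eq, one_mul, hdiag x 0]
  · rw [hoff x y (Ne.symm hxy), Matrix.one_apply_ne hxy, zero_mul]
    rfl

/-- A Pauli operator of the dual code that acts on the ancilla qubits only belongs to the code: it
is a linear combination of the syndrome projections, hence commutes with the dual code. -/
theorem mem_of_acts_on_ancillas {C : Submodule (ZMod 2) (PVec n)}
    {h : Module.Basis (Fin r) (ZMod 2) C} (hC : C ≤ symplDual C)
    (hW : IsEncoder k (fun j => (h j : PVec n)) W) {v : PVec n} (hv : v ∈ symplDual C)
    {L : Matrix (Bits r) (Bits r) ℂ}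
    (hL : Wᴴ * pauli v * W = Matrix.kroneckerMap (· * ·) (1 : Matrix (Bits k) (Bits k) ℂ) L) :
    v ∈ C := by
  set g : Fin r → PVec n := fun j => (h j : PVec n) with hg
  have hh : ∀ i j, sympl (g i) (g j) = 0 := fun i j => hC (h j).2 _ (h i).2
  have hproj : ∀ a, syndromeProj g a = W * ancillaProj k a * Wᴴ := fun a => by
    rw [← hW.syndromeProj_mul hh, Matrix.mul_assoc, hW.mul_conjTranspose_self, Matrix.mul_one]
  have hcomm : ∀ w ∈ symplDual C, ∀ a,
      pauli w * syndromeProj g a = syndromeProj g a * pauli w := fun w hw a => by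
    rw [pauli_mul_syndromeProj, (syndrome_eq_zero_iff h w).2 hw, add_zero]
  have hanc : ∀ a, ancillaProj k a *
      Matrix.kroneckerMap (· * ·) (1 : Matrix (Bits k) (Bits k) ℂ) L * ancillaProj k a =
        L a a • ancillaProj k a := fun a => by
    ext ⟨x, b⟩ ⟨y, c⟩
    rw [ancillaProj, Matrix.mul_diagonal, Matrix.diagonal_mul, Matrix.smul_apply,
      Matrix.diagonal_apply, Matrix.kroneckerMap_apply, Matrix.one_apply]
    by_cases hb : b = a <;> by_cases hc : c = a <;> by_cases hxy : x = y <;>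
      simp [hb, hc, hxy]
    all_goals grind
  have hblock : ∀ a, pauli v * syndromeProj g a = L a a • syndromeProj g a := fun a => by
    have hidem : syndromeProj g a * syndromeProj g a = syndromeProj g a := by
      rw [syndromeProj_mul_syndromeProj hh, if_pos rfl]
    calc pauli v * syndromeProj g a
        = syndromeProj g a * pauli v * syndromeProj g a := by
          rw [← hcomm v hv a, Matrix.mul_assoc, hidem]
      _ = W * (ancillaProj k a * (Wᴴ * pauli v * W) * ancillaProj k a) * Wᴴ := by
          rw [hproj a]
          simp only [Matrix.mul_assoc]
      _ = L a a • syndromeProj g a := by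
          rw [hL, hanc, hproj a, Matrix.mul_smul, Matrix.smul_mul]
  have hexp : pauli v = ∑ a, L a a • syndromeProj g a := by
    rw [← Finset.sum_congr rfl fun a _ => hblock a, ← Matrix.mul_sum, sum_syndromeProj,
      Matrix.mul_one]
  rw [← symplDual_symplDual C]
  intro w hw
  have h1 : pauli w * pauli v = pauli v * pauli w := by
    rw [hexp, Matrix.mul_sum, Matrix.sum_mul]
    exact Finset.sum_congr rfl fun a _ => by rw [Matrix.mul_smul, Matrix.smul_mul, hcomm w hw]
  have h2 := pauli_mul_comm w v
  rw [h1] at h2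
  have h3 := congrArg (fun M => (M * (pauli w * pauli v)).trace) h2
  have h4 : pauli v * pauli w * (pauli w * pauli v) = 1 := by
    rw [Matrix.mul_assoc, ← Matrix.mul_assoc (pauli w), pauli_mul_self, Matrix.one_mul,
      pauli_mul_self]
  simp only [Matrix.smul_mul, h4, Matrix.trace_smul, Matrix.trace_one, smul_eq_mul] at h3
  have h5 : (Fintype.card (Bits n) : ℂ) ≠ 0 := Nat.cast_ne_zero.2 Fintype.card_ne_zero
  exact neg_one_pow_val_eq_one_iff.1 (mul_right_cancel₀ h5 ((one_mul _).trans h3)).symm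

/-- If the hashing protocol corrects `t` errors and `e` erasures, the code has a minimum distance
greater than `2t + e`: a vector `v` of smaller weight is the sum of two errors with the same
syndrome which the decoder has to treat alike. -/
theorem lt_wt_of_hashingCorrects {C : Submodule (ZMod 2) (PVec n)}
    (h : Module.Basis (Fin r) (ZMod 2) C) (hC : C ≤ symplDual C)
    (hW : IsEncoder k (fun j => (h j : PVec n)) W)
    {U : Finset (Fin n) → Bits r → Matrix.unitaryGroup (Bits n) ℂ} {t e : ℕ}
    (hcorr : HashingCorrects (fun j => (h j : PVec n)) W U t e) {v : PVec n}
    (hv : v ∈ symplDual C) (hvC : v ∉ C) : 2 * t + e < wt v := by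
  set g : Fin r → PVec n := fun j => (h j : PVec n) with hg
  have hh : ∀ i j, sympl (g i) (g j) = 0 := fun i j => hC (h j).2 _ (h i).2
  by_contra! hle
  rw [← card_supp] at hle
  obtain ⟨E, hEsub, hE⟩ := Finset.exists_subset_card_eq (s := supp v)
    (n := min e (supp v).card) (min_le_right _ _)
  have hR := Finset.card_sdiff_of_subset hEsub
  obtain ⟨T₁, hTsub, hT₁⟩ := Finset.exists_subset_card_eq (s := supp v \ E)
    (n := min t (supp v \ E).card) (min_le_right _ _)
  have hT₂ := Finset.card_sdiff_of_subset hTsub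
  set T₂ := (supp v \ E) \ T₁ with hT₂def
  set u₁ := restrict T₁ v with hu₁
  set u₂ := restrict (T₂ ∪ E) v with hu₂
  have hsum : u₁ + u₂ = v := by
    refine restrict_add_restrict (Finset.disjoint_left.2 fun i hi hi' => ?_) fun i hi => ?_
    · have := hTsub hi
      simp only [hT₂def, Finset.mem_union, Finset.mem_sdiff] at this hi'
      tauto
    · simp only [hT₂def, Finset.mem_union, Finset.mem_sdiff]
      tauto
  have hsupp₁ : supp u₁ ⊆ T₁ ∪ E := by
    rw [supp_restrict]
    exact Finset.inter_subset_left.trans Finset.subset_union_left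
  have hsupp₂ : supp u₂ ⊆ T₂ ∪ E := by
    rw [supp_restrict]
    exact Finset.inter_subset_left
  have hout : ∀ (T : Finset (Fin n)) (u : PVec n), T.card ≤ t → supp u ⊆ T ∪ E →
      ∃ L : Matrix (Bits r) (Bits r) ℂ, correctedError g W (U E) u =
        Matrix.kroneckerMap (· * ·) (1 : Matrix (Bits k) (Bits k) ℂ) L := fun T u hT hu =>
    exists_correctedError_eq hh hW (U E) hu <| hcorr T E hT (by omega)
      (Finset.disjoint_empty_left _) _ (posSemidef_vecMulVec_self_star _) (trace_bellState _ _)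
  obtain ⟨L₁, hL₁⟩ := hout T₁ u₁ (by omega) hsupp₁
  obtain ⟨L₂, hL₂⟩ := hout T₂ u₂ (by omega) hsupp₂
  have hsyn : syndrome g u₁ = syndrome g u₂ := by
    have h1 : syndrome g (u₁ + u₂) = 0 := by rw [hsum, syndrome_eq_zero_iff h]; exact hv
    rw [map_add] at h1
    rw [add_eq_zero_iff_eq_neg.1 h1, ZModModule.neg_eq_self]
  obtain ⟨z, hz, hmul⟩ := pauli_mul u₁ u₂
  have hU : (U E (syndrome g u₂) : Matrix (Bits n) (Bits n) ℂ) *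
      (U E (syndrome g u₂) : Matrix (Bits n) (Bits n) ℂ)ᴴ = 1 :=
    Matrix.mem_unitaryGroup_iff.1 (U E (syndrome g u₂)).2
  have hprod : (correctedError g W (U E) u₁)ᴴ * correctedError g W (U E) u₂ =
      z • (Wᴴ * pauli v * W) := by
    simp only [correctedError, hsyn, Matrix.conjTranspose_mul, Matrix.conjTranspose_conjTranspose,
      pauli_conjTranspose]
    generalize (U E (syndrome g u₂) : Matrix (Bits n) (Bits n) ℂ) = V at hU ⊢
    calc Wᴴ * (pauli u₁ * (V * W)) * (Wᴴ * Vᴴ * pauli u₂ * W)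
        = Wᴴ * (pauli u₁ * (V * (W * Wᴴ) * Vᴴ) * pauli u₂) * W := by simp only [Matrix.mul_assoc]
      _ = z • (Wᴴ * pauli v * W) := by
          rw [hW.mul_conjTranspose_self, Matrix.mul_one, hU, Matrix.mul_one, hmul, hsum,
            Matrix.mul_smul, Matrix.smul_mul]
  have hprod' : (correctedError g W (U E) u₁)ᴴ * correctedError g W (U E) u₂ =
      Matrix.kroneckerMap (· * ·) (1 : Matrix (Bits k) (Bits k) ℂ) (L₁ᴴ * L₂) := by
    rw [hL₁, hL₂]
    have h1 := Matrix.conjTranspose_kronecker (1 : Matrix (Bits k) (Bits k) ℂ) L₁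
    have h2 := Matrix.mul_kronecker_mul (1 : Matrix (Bits k) (Bits k) ℂ)
      (1 : Matrix (Bits k) (Bits k) ℂ) L₁ᴴ L₂
    rw [Matrix.mul_one] at h2
    rw [Matrix.conjTranspose_one] at h1
    exact (congrArg (· * _) h1).trans h2.symm
  refine hvC (mem_of_acts_on_ancillas (L := z⁻¹ • (L₁ᴴ * L₂)) hC hW hv ?_)
  have h3 := Matrix.kronecker_smul z⁻¹ (1 : Matrix (Bits k) (Bits k) ℂ) (L₁ᴴ * L₂)
  refine Eq.trans ?_ h3.symm
  refine Eq.trans ?_ (congrArg (z⁻¹ • ·) (hprod.symm.trans hprod'))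
  rw [smul_smul, inv_mul_cancel₀ hz, one_smul]

end Hashing

end EntDist

theorem mainTheorem2 (m k d : ℕ)
    (hrow : (m, k, d) ∈
      ({(5, 3, 2), (7, 2, 3), (9, 1, 4), (15, 1, 6), (20, 14, 3)} : Set (ℕ × ℕ × ℕ))) :
    -- a pure `[[m+1, k+1, d]]` code exists
    (∃ C : Submodule (ZMod 2) (EntDist.PVec (m + 1)),
      EntDist.IsPureStabilizerCode (m + 1) (k + 1) d C) ∧
    -- each such code gives a breeding protocol from `m` noisy pairs and one preshared pair
    -- to `k + 1` pairs, a net gain of `k` pairs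
    (∀ C : Submodule (ZMod 2) (EntDist.PVec (m + 1)),
      EntDist.IsPureStabilizerCode (m + 1) (k + 1) d C →
      ∀ i : Fin (m + 1),
        EntDist.IsEACode m (k + 1) d 1 (EntDist.puncture i C) ∧
        ∀ (r : ℕ) (h : Module.Basis (Fin r) (ZMod 2) C),
          (∃ W : Matrix (EntDist.Bits (m + 1)) (EntDist.Bits (k + 1) × EntDist.Bits r) ℂ,
            EntDist.IsEncoder (k + 1) (fun j => (h j : EntDist.PVec (m + 1))) W) ∧
          ∃ U : Finset (Fin (m + 1)) → EntDist.Bits r →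
              Matrix.unitaryGroup (EntDist.Bits (m + 1)) ℂ,
            ∀ W : Matrix (EntDist.Bits (m + 1)) (EntDist.Bits (k + 1) × EntDist.Bits r) ℂ,
              EntDist.IsEncoder (k + 1) (fun j => (h j : EntDist.PVec (m + 1))) W →
              ∀ t e : ℕ, 2 * t + e < d →
                EntDist.BreedingCorrects i (fun j => (h j : EntDist.PVec (m + 1))) W U t e) ∧
    -- no `[[m, k]]` code has minimum distance `d` or more
    (∀ d' : ℕ, d ≤ d' →
      ¬ ∃ C : Submodule (ZMod 2) (EntDist.PVec m), EntDist.IsStabilizerCode m k d' C) ∧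
    -- no hashing protocol of a stabilizer code turns `m` noisy pairs into `k` pairs
    -- and corrects `t` errors and `e` erasures with `2t + e = d - 1`
    (∀ C : Submodule (ZMod 2) (EntDist.PVec m), C ≤ EntDist.symplDual C →
      ∀ (r : ℕ) (h : Module.Basis (Fin r) (ZMod 2) C), r + k = m →
      ∀ W : Matrix (EntDist.Bits m) (EntDist.Bits k × EntDist.Bits r) ℂ,
        EntDist.IsEncoder k (fun j => (h j : EntDist.PVec m)) W →
      ∀ U : Finset (Fin m) → EntDist.Bits r → Matrix.unitaryGroup (EntDist.Bits m) ℂ,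
      ∀ t e : ℕ, 2 * t + e + 1 = d →
        ¬ EntDist.HashingCorrects (fun j => (h j : EntDist.PVec m)) W U t e) := by
  have hd : 2 ≤ d := by
    simp only [Set.mem_insert_iff, Set.mem_singleton_iff, Prod.mk.injEq] at hrow
    omega
  refine ⟨EntDist.exists_isPureStabilizerCode hrow, fun C hC i =>
    ⟨EntDist.isEACode_puncture hC hd i, fun r h => ⟨?_, ?_⟩⟩, ?_, ?_⟩
  · refine EntDist.exists_isEncoder (fun a b => hC.self_orthogonal (h b).2 _ (h a).2)
      (EntDist.syndrome_surjective h) ?_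
    rw [← hC.dim_eq, Module.finrank_eq_card_basis h, Fintype.card_fin]
  · obtain ⟨U, hU⟩ := EntDist.exists_decoder hC h
    exact ⟨U, fun W hW t e hte => hU W hW t e hte {i}⟩
  · rintro d' hd' ⟨C, hC⟩
    obtain ⟨v, hv, hvC, hlt⟩ := EntDist.exists_wt_lt hrow hC.self_orthogonal hC.dim_eq
    have := hC.dist_eq.2 ⟨v, hv, hvC, rfl⟩
    omega
  · intro C hC r h hr W hW U t e hte hcorr
    obtain ⟨v, hv, hvC, hlt⟩ := EntDist.exists_wt_lt hrow hC
      (by rw [Module.finrank_eq_card_basis h, Fintype.card_fin, hr])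
    have := EntDist.lt_wt_of_hashingCorrects h hC hW hcorr hv hvC
    omega
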